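/- Let $\mathcal H(\mathbb C)$ be the set of entire functions and let $A$ be the Lebesgue area measure on $\mathbb C$. For $1\le p\le\infty$ let $\mathcal F_p$ be the Fock space of all $f\in\mathcal H(\mathbb C)$ with $\|f\|_p<\infty$, where $$\|f\|_p=\Big(\frac p{2\pi}\int_{\mathbb C}|f(z)|^pe^{-\frac p2|z|^2}\,dA(z)\Big)^{1/p}\quad(p<\infty),\qquad \|f\|_\infty=\sup_{z\in\mathbb C}|f(z)|e^{-\frac12|z|^2}.$$ For $u,\psi\in\mathcal H(\mathbb C)$ and an integer $n\ge0$ put $D_{(u,\psi,n)}f=u\cdot(f^{(n)}\circ\psi)$ and $$L_{(u,\psi,n)}(z)=|u(z)|\,|\psi(z)|^n\,e^{\frac12(|\psi(z)|^2-|z|^2)},\qquad z\in\mathbb C.$$ For an integer $k\ge 0$, a set $S\subseteq\mathbb C$ is called a $(p,k)$ sampling set for a non-empty set $M\subseteq\mathcal F_p$ if there is a constant $\delta>0$ such that for all $f\in M$ $$\delta\|f\|_p\le\Big(\int_S\frac{|f^{(k)}(z)|^p}{(1+|z|)^{kp}}e^{-\frac p2|z|^2}\,dA(z)\Big)^{1/p}\quad(p<\infty),\qquad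 \delta\|f\|_\infty\le\sup_{z\in S}\frac{|f^{(k)}(z)|}{(1+|z|)^k}e^{-\frac12|z|^2}\quad(p=\infty),$$ where a supremum over the empty set is $0$. Theorem. Let $1\le p\le\infty$, let $n\ge0$ be an integer, let $u,\psi\in\mathcal H(\mathbb C)$ with $u$ not identically zero and $\psi$ not constant, and suppose that $D_{(u,\psi,n)}$ maps $\mathcal F_p$ into $\mathcal F_p$ and is bounded there. Then $D_{(u,\psi,n)}:\mathcal F_p\to\mathcal F_p$ has closed range if and only if there exists $\varepsilon>0$ such that the set $\psi(\{z\in\mathbb C: L_{(u,\psi,n)}(z)>\varepsilon\})$ is a $(p,n)$ sampling set for $$\mathcal F^0_{(p,n)}=\{f\in\mathcal F_p: f(0)=f'(0)=\dots=f^{(n-1)}(0)=0\}.$$ -/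

import Mathlib

open MeasureTheory
open scoped ENNReal

noncomputable section

/-- The Fock norm `‖f‖_p` of a function `f : ℂ → ℂ`, as an extended nonnegative real number.
For `p < ∞` it is `((p / 2π) ∫ |f z|^p e^{-p|z|²/2} dA(z))^{1/p}` with `A` the area measure,
and for `p = ∞` it is `sup_z |f z| e^{-|z|²/2}`. -/
def fockENorm (p : ℝ≥0∞) (f : ℂ → ℂ) : ℝ≥0∞ :=
  if p = ∞ then ⨆ z : ℂ, ENNReal.ofReal (‖f z‖ * Real.exp (-‖z‖ ^ 2 / 2))
  else (ENNReal.ofReal (p.toReal / (2 * Real.pi)) *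
    ∫⁻ z : ℂ, ENNReal.ofReal (‖f z‖ ^ p.toReal * Real.exp (-(p.toReal / 2) * ‖z‖ ^ 2)))
      ^ (1 / p.toReal)

theorem fockENorm_top (f : ℂ → ℂ) :
    fockENorm ∞ f = ⨆ z : ℂ, ENNReal.ofReal (‖f z‖ * Real.exp (-‖z‖ ^ 2 / 2)) :=
  if_pos rfl

theorem fockENorm_of_ne_top {p : ℝ≥0∞} (hp : p ≠ ∞) (f : ℂ → ℂ) :
    fockENorm p f = (ENNReal.ofReal (p.toReal / (2 * Real.pi)) *
      ∫⁻ z : ℂ, ENNReal.ofReal (‖f z‖ ^ p.toReal * Real.exp (-(p.toReal / 2) * ‖z‖ ^ 2)))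
        ^ (1 / p.toReal) :=
  if_neg hp

theorem fockENorm_eq_eLpNorm {p : ℝ≥0∞} (h1 : 1 ≤ p) (hp : p ≠ ∞) (f : ℂ → ℂ) :
    fockENorm p f = eLpNorm (fun z : ℂ => f z * (Real.exp (-‖z‖ ^ 2 / 2) : ℂ)) p
      (ENNReal.ofReal (p.toReal / (2 * Real.pi)) • volume) := by
  have h0 : p ≠ 0 := (zero_lt_one.trans_le h1).ne'
  rw [fockENorm_of_ne_top hp, eLpNorm_eq_lintegral_rpow_enorm_toReal h0 hp,
    lintegral_smul_measure, smul_eq_mul]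
  congr 2
  refine lintegral_congr fun z => ?_
  rw [← ofReal_norm, ENNReal.ofReal_rpow_of_nonneg (norm_nonneg _) ENNReal.toReal_nonneg,
    norm_mul, Complex.norm_real, Real.norm_of_nonneg (Real.exp_pos _).le,
    Real.mul_rpow (norm_nonneg _) (Real.exp_pos _).le, ← Real.exp_mul]
  congr 3
  ring

theorem fockENorm_zero {p : ℝ≥0∞} (h1 : 1 ≤ p) : fockENorm p 0 = 0 := by
  by_cases hp : p = ∞
  · subst hp; simp [fockENorm_top]
  · rw [fockENorm_eq_eLpNorm h1 hp]; simp

theorem fockENorm_add_le {p : ℝ≥0∞} (h1 : 1 ≤ p) {f g : ℂ → ℂ}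
    (hf : Continuous f) (hg : Continuous g) :
    fockENorm p (f + g) ≤ fockENorm p f + fockENorm p g := by
  by_cases hp : p = ∞
  · subst hp
    simp only [fockENorm_top]
    refine iSup_le fun z => ?_
    refine le_trans ?_ (add_le_add
      (le_iSup (fun z : ℂ => ENNReal.ofReal (‖f z‖ * Real.exp (-‖z‖ ^ 2 / 2))) z)
      (le_iSup (fun z : ℂ => ENNReal.ofReal (‖g z‖ * Real.exp (-‖z‖ ^ 2 / 2))) z))
    rw [← ENNReal.ofReal_add (by positivity) (by positivity), ← add_mul]
    exact ENNReal.ofReal_le_ofReal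
      (mul_le_mul_of_nonneg_right (norm_add_le _ _) (Real.exp_pos _).le)
  · simp only [fockENorm_eq_eLpNorm h1 hp]
    refine le_trans (le_of_eq ?_) (eLpNorm_add_le
      (Continuous.aestronglyMeasurable (by fun_prop))
      (Continuous.aestronglyMeasurable (by fun_prop)) h1)
    congr 1
    funext z
    simp [add_mul]

theorem fockENorm_smul {p : ℝ≥0∞} (h1 : 1 ≤ p) (c : ℂ) (f : ℂ → ℂ) :
    fockENorm p (c • f) = ‖c‖ₑ * fockENorm p f := by
  by_cases hp : p = ∞
  · subst hp
    simp only [fockENorm_top, ENNReal.mul_iSup]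
    refine iSup_congr fun z => ?_
    rw [← ofReal_norm, ← ENNReal.ofReal_mul (norm_nonneg _), Pi.smul_apply, norm_smul,
      mul_assoc]
  · simp only [fockENorm_eq_eLpNorm h1 hp]
    rw [← eLpNorm_const_smul]
    congr 1
    funext z
    simp [mul_assoc]

theorem eq_zero_of_fockENorm_eq_zero {p : ℝ≥0∞} (h1 : 1 ≤ p) {f : ℂ → ℂ} (hf : Continuous f)
    (h : fockENorm p f = 0) : f = 0 := by
  by_cases hp : p = ∞
  · subst hp
    rw [fockENorm_top, ENNReal.iSup_eq_zero] at h
    funext z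
    have hz := ENNReal.ofReal_eq_zero.1 (h z)
    have he := Real.exp_pos (-‖z‖ ^ 2 / 2)
    have : ‖f z‖ ≤ 0 := by
      by_contra hcon
      exact absurd hz (not_le.2 (mul_pos (not_le.1 hcon) he))
    simpa using this
  · have h0 : p ≠ 0 := (zero_lt_one.trans_le h1).ne'
    have hc : Continuous fun z : ℂ => f z * (Real.exp (-‖z‖ ^ 2 / 2) : ℂ) := by fun_prop
    have hk : ENNReal.ofReal (p.toReal / (2 * Real.pi)) ≠ 0 := by
      have := ENNReal.toReal_pos h0 hp
      rw [Ne, ENNReal.ofReal_eq_zero, not_le]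
      positivity
    rw [fockENorm_eq_eLpNorm h1 hp, eLpNorm_eq_zero_iff hc.aestronglyMeasurable h0,
      Filter.EventuallyEq, Measure.ae_ennreal_smul_measure_iff hk] at h
    have := (Continuous.ae_eq_iff_eq (μ := (volume : Measure ℂ)) hc continuous_zero).1 h
    funext z
    have hz := congrFun this z
    simpa using hz

/-- The entire functions with finite Fock norm, as a linear subspace of `ℂ → ℂ`. -/
def fockSubmodule (p : ℝ≥0∞) [hp : Fact (1 ≤ p)] : Submodule ℂ (ℂ → ℂ) where
  carrier := {f | Differentiable ℂ f ∧ fockENorm p f < ∞}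
  zero_mem' := ⟨differentiable_const 0, by rw [fockENorm_zero hp.out]; exact ENNReal.zero_lt_top⟩
  add_mem' := fun {f g} hf hg => ⟨hf.1.add hg.1,
    (fockENorm_add_le hp.out hf.1.continuous hg.1.continuous).trans_lt
      (ENNReal.add_lt_top.2 ⟨hf.2, hg.2⟩)⟩
  smul_mem' := fun c f hf => ⟨hf.1.const_smul c, by
    rw [fockENorm_smul hp.out]
    exact ENNReal.mul_lt_top enorm_lt_top hf.2⟩

/-- The Fock space `F_p`, `1 ≤ p ≤ ∞`, with the topology of the Fock norm (a type of its own, so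
that it does not inherit the topology of pointwise convergence from `ℂ → ℂ`). -/
def FockSpace (p : ℝ≥0∞) [Fact (1 ≤ p)] : Type := fockSubmodule p

namespace FockSpace

variable {p : ℝ≥0∞} [Fact (1 ≤ p)]

instance : AddCommGroup (FockSpace p) := inferInstanceAs (AddCommGroup (fockSubmodule p))

instance : Module ℂ (FockSpace p) := inferInstanceAs (Module ℂ (fockSubmodule p))

instance : CoeFun (FockSpace p) fun _ => ℂ → ℂ := ⟨fun f => f.1⟩

instance : Norm (FockSpace p) := ⟨fun f => (fockENorm p f).toReal⟩

theorem norm_def (f : FockSpace p) : ‖f‖ = (fockENorm p f).toReal := rfl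

theorem core : NormedSpace.Core ℂ (FockSpace p) where
  norm_nonneg _ := ENNReal.toReal_nonneg
  norm_smul c f := by
    have h := fockENorm_smul (Fact.out : 1 ≤ p) c f.1
    change (fockENorm p (c • f.1)).toReal = ‖c‖ * (fockENorm p f.1).toReal
    rw [h, ENNReal.toReal_mul, toReal_enorm]
  norm_triangle f g := by
    have h := fockENorm_add_le (Fact.out : 1 ≤ p) f.2.1.continuous g.2.1.continuous
    change (fockENorm p (f.1 + g.1)).toReal ≤ (fockENorm p f.1).toReal + (fockENorm p g.1).toReal
    rw [← ENNReal.toReal_add f.2.2.ne g.2.2.ne]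
    exact ENNReal.toReal_mono (ENNReal.add_lt_top.2 ⟨f.2.2, g.2.2⟩).ne h
  norm_eq_zero_iff f := by
    constructor
    · intro h
      have h' : fockENorm p f.1 = 0 :=
        ((ENNReal.toReal_eq_zero_iff _).1 h).resolve_right f.2.2.ne
      exact Subtype.ext (eq_zero_of_fockENorm_eq_zero Fact.out f.2.1.continuous h')
    · rintro rfl
      change (fockENorm p 0).toReal = 0
      rw [fockENorm_zero (Fact.out : 1 ≤ p), ENNReal.toReal_zero]

instance : NormedAddCommGroup (FockSpace p) := NormedAddCommGroup.ofCore core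

instance : NormedSpace ℂ (FockSpace p) := NormedSpace.ofCore core

/-- The subspace of the functions in `F_p` that vanish to order `n` at the origin,
`f(0) = f'(0) = ⋯ = f^{(n-1)}(0) = 0`. -/
def vanishing (p : ℝ≥0∞) [Fact (1 ≤ p)] (n : ℕ) : Set (FockSpace p) :=
  {f | ∀ j < n, iteratedDeriv j f 0 = 0}

/-- The right-hand side of the sampling inequality: `sup_{z ∈ S} |f^{(k)}(z)| (1+|z|)^{-k} e^{-|z|²/2}`
if `p = ∞`, and `(∫_S |f^{(k)}(z)|^p (1+|z|)^{-kp} e^{-p|z|²/2} dA(z))^{1/p}` if `p < ∞`. -/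
def samplingENorm (p : ℝ≥0∞) (k : ℕ) (S : Set ℂ) (f : ℂ → ℂ) : ℝ≥0∞ :=
  if p = ∞ then
    ⨆ z ∈ S, ENNReal.ofReal
      (‖iteratedDeriv k f z‖ / (1 + ‖z‖) ^ k * Real.exp (-‖z‖ ^ 2 / 2))
  else
    (∫⁻ z in S, ENNReal.ofReal
      (‖iteratedDeriv k f z‖ ^ p.toReal / (1 + ‖z‖) ^ (k * p.toReal) *
        Real.exp (-(p.toReal / 2) * ‖z‖ ^ 2))) ^ (1 / p.toReal)

/-- `S` is a `(p, k)` sampling set for the set `M` of functions in `F_p`. -/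
def IsSamplingSet (p : ℝ≥0∞) [Fact (1 ≤ p)] (k : ℕ) (S : Set ℂ) (M : Set (FockSpace p)) : Prop :=
  ∃ δ : ℝ, 0 < δ ∧ ∀ f ∈ M, ENNReal.ofReal (δ * ‖f‖) ≤ samplingENorm p k S f

end FockSpace

/-- The weighted composition-differentiation operator `D_{(u,ψ,n)} f = u · (f^{(n)} ∘ ψ)`. -/
def weightedCompDiff (u ψ : ℂ → ℂ) (n : ℕ) (f : ℂ → ℂ) : ℂ → ℂ :=
  fun z => u z * iteratedDeriv n f (ψ z)

/-- `L_{(u,ψ,n)}(z) = |u(z)| |ψ(z)|^n e^{(|ψ(z)|² - |z|²)/2}`. -/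
def weightL (u ψ : ℂ → ℂ) (n : ℕ) (z : ℂ) : ℝ :=
  ‖u z‖ * ‖ψ z‖ ^ n * Real.exp ((‖ψ z‖ ^ 2 - ‖z‖ ^ 2) / 2)

/-- The map `D_{(u,ψ,n)}` sends `F_p` into itself and is bounded. -/
def IsBoundedOnFock (p : ℝ≥0∞) [Fact (1 ≤ p)] (u ψ : ℂ → ℂ) (n : ℕ) : Prop :=
  ∃ T : FockSpace p →L[ℂ] FockSpace p, ∀ f : FockSpace p, T f = weightedCompDiff u ψ n f

/-- The range of `D_{(u,ψ,n)}` on `F_p`, as a subset of `F_p`. -/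
def rangeOnFock (p : ℝ≥0∞) [Fact (1 ≤ p)] (u ψ : ℂ → ℂ) (n : ℕ) : Set (FockSpace p) :=
  {g | ∃ f : FockSpace p, g = weightedCompDiff u ψ n f}

end

open Filter Topology

noncomputable section

/-! The weighted modulus of the image at `z` factors as `weightAmplitude` at `z` times the weighted
modulus of the `n`-th derivative at `ψ z` (`gaussModulus_weightedCompDiff`). The amplitude is
`weightL` with `(1 + |ψ|)^n` in place of `|ψ|^n`, so the two are comparable where `|ψ| ≥ 1`.

Testing the bounded operator on normalized reproducing kernels shows that `weightL` is bounded
(`exists_weightL_le`). Jensen's formula then forces `ψ` to be affine (`exists_affine_of_bounded`).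
Hence `ψ` is a homeomorphism of the plane that scales area by a constant, and integrals in `z`
become integrals in `ψ z`.

Subtracting a Taylor polynomial of degree below `n` does not change the image of a function, and the
operator is injective on the functions vanishing to order `n` at the origin. Since the Fock space is
complete, closed range means `c‖f‖ ≤ ‖T f‖` on that subspace (`isClosed_rangeOnFock_iff`).

Sampling gives this lower bound because the amplitude exceeds `ε` wherever `weightL` does
(`exists_samplingENorm_le`). For the converse, the plane is split into three regions. Where `weightL
> ε`, the sampling term appears. Where `weightL ≤ ε` and `|ψ| ≥ 1`, the amplitude is at most `2^n
ε`, and the weighted derivative is controlled by `‖f‖`, so the contribution is absorbed. Where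
`weightL ≤ ε` and `|ψ| < 1`, the amplitude need not be small, since `ψ` may vanish. For `p < ∞` this
last region has area tending to zero with `ε` (`exists_isSamplingSet_of_ne_top`). For `p = ∞` the
maximum principle bounds `T f` there by its values on a curve `|ψ| = r` that lies in the first
region (`exists_isSamplingSet_top`). -/

/-- The Gaussian-weighted modulus `|f z| e^{-|z|²/2}`. -/
def gaussModulus (f : ℂ → ℂ) (z : ℂ) : ℝ := ‖f z‖ * Real.exp (-‖z‖ ^ 2 / 2)

/-- The weighted modulus `|f^{(n)} z| (1+|z|)^{-n} e^{-|z|²/2}` of the `n`-th derivative. -/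
def derivModulus (n : ℕ) (f : ℂ → ℂ) (z : ℂ) : ℝ :=
  ‖iteratedDeriv n f z‖ / (1 + ‖z‖) ^ n * Real.exp (-‖z‖ ^ 2 / 2)

theorem gaussModulus_nonneg (f : ℂ → ℂ) (z : ℂ) : 0 ≤ gaussModulus f z := by
  unfold gaussModulus; positivity

theorem derivModulus_nonneg (n : ℕ) (f : ℂ → ℂ) (z : ℂ) : 0 ≤ derivModulus n f z := by
  unfold derivModulus; positivity

theorem differentiable_iteratedDeriv {f : ℂ → ℂ} (hf : Differentiable ℂ f) (n : ℕ) :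
    Differentiable ℂ (iteratedDeriv n f) :=
  (hf.contDiff (n := (⊤ : ℕ∞))).differentiable_iteratedDeriv n (by exact_mod_cast ENat.natCast_lt_top n)

theorem continuous_gaussModulus {f : ℂ → ℂ} (hf : Continuous f) : Continuous (gaussModulus f) := by
  unfold gaussModulus; fun_prop

theorem continuous_derivModulus {f : ℂ → ℂ} (hf : Differentiable ℂ f) (n : ℕ) :
    Continuous (derivModulus n f) := by
  have := (differentiable_iteratedDeriv hf n).continuous
  unfold derivModulus
  refine (this.norm.div (by fun_prop) fun z => ?_).mul (by fun_prop)
  positivity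

/-! ### Local estimates: sub-mean value property and Cauchy's inequality. -/

/-- The sub-mean value property of `|f|^q` at the origin, over the unit circle. -/
theorem enorm_rpow_le_lintegral_circle {f : ℂ → ℂ} (hf : Differentiable ℂ f) {q : ℝ}
    (hq : 1 ≤ q) (z : ℂ) :
    ‖f 0‖ₑ ^ q ≤ ∫⁻ θ in Set.Ioc 0 (2 * Real.pi),
      ‖f (circleMap 0 1 θ * z)‖ₑ ^ q ∂(ENNReal.ofReal (2 * Real.pi)⁻¹ • volume) := by
  set ν : Measure ℝ := (ENNReal.ofReal (2 * Real.pi)⁻¹ • (volume : Measure ℝ)).restrict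
    (Set.Ioc 0 (2 * Real.pi)) with hν
  have hpi := Real.pi_pos
  have hprob : IsProbabilityMeasure ν := by
    refine ⟨?_⟩
    rw [hν, Measure.restrict_apply_univ, Measure.smul_apply, Real.volume_Ioc, sub_zero, smul_eq_mul,
      ← ENNReal.ofReal_mul (by positivity), inv_mul_cancel₀ (by positivity), ENNReal.ofReal_one]
  have hc : Continuous fun θ : ℝ => f (circleMap 0 1 θ * z) :=
    hf.continuous.comp ((continuous_circleMap 0 1).mul continuous_const)
  have hmean : f 0 = ∫ θ, f (circleMap 0 1 θ * z) ∂ν := by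
    have h1 : Differentiable ℂ fun ζ : ℂ => f (ζ * z) :=
      hf.comp (differentiable_id.mul_const z)
    have h2 := (h1.diffContOnCl (s := Metric.ball 0 |1|)).circleAverage
    rw [Real.circleAverage_def, intervalIntegral.integral_of_le (by positivity)] at h2
    rw [hν, Measure.restrict_smul, integral_smul_measure, ENNReal.toReal_ofReal (by positivity), h2,
      zero_mul]
  have h1 : ‖f 0‖ₑ ≤ eLpNorm (fun θ : ℝ => f (circleMap 0 1 θ * z)) 1 ν := by
    rw [eLpNorm_one_eq_lintegral_enorm]
    conv_lhs => rw [hmean]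
    exact enorm_integral_le_lintegral_enorm _
  have hq0 : 0 < q := by linarith
  have h2 := h1.trans (eLpNorm_le_eLpNorm_of_exponent_le (q := ENNReal.ofReal q)
    (by simpa using hq) hc.aestronglyMeasurable)
  rw [eLpNorm_eq_lintegral_rpow_enorm_toReal (by simpa using hq0) ENNReal.ofReal_ne_top,
    ENNReal.toReal_ofReal hq0.le, one_div, ENNReal.le_rpow_inv_iff hq0] at h2
  exact h2

/-- Integrate the circle inequality over the disc and swap the integrals. Each rotation preserves
the disc and its area, so the inner integral no longer depends on the angle. -/
theorem enorm_rpow_mul_volume_le {f : ℂ → ℂ} (hf : Differentiable ℂ f) {q : ℝ} (hq : 1 ≤ q) :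
    ‖f 0‖ₑ ^ q * volume (Metric.ball (0 : ℂ) 1) ≤ ∫⁻ z in Metric.ball (0 : ℂ) 1, ‖f z‖ₑ ^ q := by
  have hq0 : 0 < q := by linarith
  have hcont : Continuous fun x : ℂ × ℝ => f (circleMap 0 1 x.2 * x.1) :=
    hf.continuous.comp (((continuous_circleMap 0 1).comp continuous_snd).mul continuous_fst)
  have hpi := Real.pi_pos
  calc ‖f 0‖ₑ ^ q * volume (Metric.ball (0 : ℂ) 1)
      = ∫⁻ z in Metric.ball (0 : ℂ) 1, ‖f 0‖ₑ ^ q := by simp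
    _ ≤ ∫⁻ z in Metric.ball (0 : ℂ) 1, ∫⁻ θ in Set.Ioc 0 (2 * Real.pi),
      ‖f (circleMap 0 1 θ * z)‖ₑ ^ q ∂(ENNReal.ofReal (2 * Real.pi)⁻¹ • volume) :=
        lintegral_mono fun z => enorm_rpow_le_lintegral_circle hf hq z
    _ = ∫⁻ θ in Set.Ioc 0 (2 * Real.pi), (∫⁻ z in Metric.ball (0 : ℂ) 1,
      ‖f (circleMap 0 1 θ * z)‖ₑ ^ q) ∂(ENNReal.ofReal (2 * Real.pi)⁻¹ • volume) := by
        refine lintegral_lintegral_swap ?_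
        exact ((hcont.enorm.measurable).pow_const q).aemeasurable
    _ = ∫⁻ θ in Set.Ioc 0 (2 * Real.pi), (∫⁻ z in Metric.ball (0 : ℂ) 1,
      ‖f z‖ₑ ^ q) ∂(ENNReal.ofReal (2 * Real.pi)⁻¹ • volume) := by
        refine lintegral_congr fun θ => ?_
        have hc : circleMap 0 1 θ = (Circle.exp θ : ℂ) := by simp [circleMap]
        have hm := ((rotation (Circle.exp θ)).measurePreserving).setLIntegral_comp_preimage_emb
          (rotation (Circle.exp θ)).toHomeomorph.measurableEmbedding (fun z => ‖f z‖ₑ ^ q)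
          (Metric.ball (0 : ℂ) 1)
        rw [← hm, (rotation (Circle.exp θ)).preimage_ball, map_zero]
        simp [hc, rotation_apply]
    _ = ∫⁻ z in Metric.ball (0 : ℂ) 1, ‖f z‖ₑ ^ q := by
        rw [lintegral_const, Measure.restrict_apply_univ, Measure.smul_apply, Real.volume_Ioc,
          sub_zero, smul_eq_mul, ← ENNReal.ofReal_mul (by positivity),
          inv_mul_cancel₀ (by positivity), ENNReal.ofReal_one, mul_one]

theorem volume_ball_one_ne_zero : volume (Metric.ball (0 : ℂ) 1) ≠ 0 :=
  (Metric.measure_ball_pos _ _ one_pos).ne'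

theorem volume_ball_ne_top (r : ℝ) : volume (Metric.ball (0 : ℂ) r) ≠ ∞ :=
  measure_ball_lt_top.ne

theorem setLIntegral_ball_add (w : ℂ) (r : ℝ) (F : ℂ → ℝ≥0∞) :
    ∫⁻ z in Metric.ball (0 : ℂ) r, F (z + w) = ∫⁻ z in Metric.ball w r, F z := by
  rw [← (measurePreserving_add_right volume w).setLIntegral_comp_preimage_emb
    (measurableEmbedding_addRight w) F (Metric.ball w r)]
  congr 2
  ext z
  simp [dist_eq_norm]

theorem norm_sq_add (z w : ℂ) :
    ‖z + w‖ ^ 2 = ‖z‖ ^ 2 + ‖w‖ ^ 2 + 2 * (starRingEnd ℂ w * z).re := by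
  rw [← Complex.normSq_eq_norm_sq, ← Complex.normSq_eq_norm_sq, ← Complex.normSq_eq_norm_sq,
    Complex.normSq_add, mul_comm (starRingEnd ℂ w) z]

theorem gaussModulus_rpow_le {f : ℂ → ℂ} (hf : Differentiable ℂ f) {q : ℝ} (hq : 1 ≤ q) (w : ℂ) :
    ENNReal.ofReal (gaussModulus f w) ^ q ≤
      ENNReal.ofReal (Real.exp (1 / 2)) ^ q / volume (Metric.ball (0 : ℂ) 1) *
        ∫⁻ z in Metric.ball w 1, ENNReal.ofReal (gaussModulus f z) ^ q := by
  have hq0 : 0 < q := by linarith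
  -- The zero-free exponential cancels the cross term of `|z + w|²`, which moves the Gaussian weight
  -- from `w` to the origin. Only `e^{|z|²/2}` is left over, at most `e^{1/2}` on the unit disc.
  set h : ℂ → ℂ := fun z =>
    f (z + w) * Complex.exp (-(starRingEnd ℂ w * z) - (‖w‖ ^ 2 / 2 : ℝ)) with hh
  have hd : Differentiable ℂ h := by
    refine (hf.comp (differentiable_id.add_const w)).mul ?_
    fun_prop
  have hnorm : ∀ z, ‖h z‖ = gaussModulus f (z + w) * Real.exp (‖z‖ ^ 2 / 2) := by
    intro z
    simp only [hh, gaussModulus, norm_mul, Complex.norm_exp, norm_sq_add]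
    rw [mul_assoc, ← Real.exp_add]
    congr 2
    simp only [Complex.sub_re, Complex.neg_re, Complex.ofReal_re]
    ring
  have h0 : ‖h 0‖ₑ = ENNReal.ofReal (gaussModulus f w) := by
    rw [← ofReal_norm, hnorm]; simp
  have hb := enorm_rpow_mul_volume_le hd hq
  rw [h0] at hb
  rw [← ENNReal.mul_div_right_comm]
  refine (ENNReal.le_div_iff_mul_le (Or.inl volume_ball_one_ne_zero)
    (Or.inl (volume_ball_ne_top 1))).2 (hb.trans ?_)
  rw [← setLIntegral_ball_add w 1, ← lintegral_const_mul' _ _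
    (ENNReal.rpow_ne_top_of_nonneg hq0.le ENNReal.ofReal_ne_top)]
  refine setLIntegral_mono' Metric.isOpen_ball.measurableSet fun z hz => ?_
  rw [← ENNReal.mul_rpow_of_nonneg _ _ hq0.le, ← ofReal_norm, hnorm,
    ← ENNReal.ofReal_mul (Real.exp_pos _).le, mul_comm]
  have hz1 : ‖z‖ ≤ 1 := by simpa using (mem_ball_zero_iff.1 hz).le
  refine ENNReal.rpow_le_rpow (ENNReal.ofReal_le_ofReal ?_) hq0.le
  refine mul_le_mul_of_nonneg_right (Real.exp_le_exp.2 ?_) (gaussModulus_nonneg _ _)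
  nlinarith [norm_nonneg z]

/-- Cauchy's estimate on the disc of radius `1/(1+|w|)`, on which the Gaussian weight is
comparable to its value at the centre. -/
theorem derivModulus_le {f : ℂ → ℂ} (hf : Differentiable ℂ f) (n : ℕ) (w : ℂ) {B : ℝ}
    (hB : ∀ z ∈ Metric.closedBall w 1, gaussModulus f z ≤ B) :
    derivModulus n f w ≤ n.factorial * Real.exp (3 / 2) * B := by
  have hw := norm_nonneg w
  have hB0 : 0 ≤ B := (gaussModulus_nonneg f w).trans (hB w (by simp))
  have hR : 0 < (1 + ‖w‖)⁻¹ := by positivity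
  have hR1 : (1 + ‖w‖)⁻¹ ≤ 1 := inv_le_one_of_one_le₀ (by linarith)
  have key := Complex.norm_iteratedDeriv_le_of_forall_mem_sphere_norm_le (f := f) (c := w)
    (C := Real.exp (3 / 2) * B * Real.exp (‖w‖ ^ 2 / 2)) n hR hf.diffContOnCl ?_
  · unfold derivModulus
    rw [inv_pow, div_inv_eq_mul] at key
    calc ‖iteratedDeriv n f w‖ / (1 + ‖w‖) ^ n * Real.exp (-‖w‖ ^ 2 / 2)
        ≤ (n.factorial * (Real.exp (3 / 2) * B * Real.exp (‖w‖ ^ 2 / 2)) * (1 + ‖w‖) ^ n) /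
          (1 + ‖w‖) ^ n * Real.exp (-‖w‖ ^ 2 / 2) := by gcongr
      _ = n.factorial * Real.exp (3 / 2) * B *
          (Real.exp (‖w‖ ^ 2 / 2) * Real.exp (-‖w‖ ^ 2 / 2)) := by
        rw [mul_div_cancel_right₀ _ (by positivity)]; ring
      _ = _ := by rw [← Real.exp_add, neg_div, add_neg_cancel, Real.exp_zero, mul_one]
  · intro z hz
    have hzw : ‖z - w‖ = (1 + ‖w‖)⁻¹ := by simpa [dist_eq_norm] using hz
    have hz1 := hB z (by simpa [dist_eq_norm, hzw] using hR1)
    have hzn : ‖z‖ ≤ ‖w‖ + (1 + ‖w‖)⁻¹ := by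
      have := norm_add_le w (z - w)
      rw [hzw] at this; simpa using this
    -- With `R = 1/(1+|w|)` one has `2|w|R ≤ 2` and `R² ≤ 1`, so `|z|²` exceeds `|w|²` by at most
    -- `3`.
    have hsq : ‖z‖ ^ 2 / 2 ≤ 3 / 2 + ‖w‖ ^ 2 / 2 := by
      have h1 : ‖z‖ ^ 2 ≤ (‖w‖ + (1 + ‖w‖)⁻¹) ^ 2 := by gcongr
      have h2 : ‖w‖ * (1 + ‖w‖)⁻¹ ≤ 1 := by
        rw [← div_eq_mul_inv, div_le_one (by positivity)]; linarith
      nlinarith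
    have : ‖f z‖ = gaussModulus f z * Real.exp (‖z‖ ^ 2 / 2) := by
      rw [gaussModulus, mul_assoc, ← Real.exp_add, neg_div, neg_add_cancel, Real.exp_zero, mul_one]
    rw [this]
    calc gaussModulus f z * Real.exp (‖z‖ ^ 2 / 2) ≤ B * Real.exp (3 / 2 + ‖w‖ ^ 2 / 2) := by gcongr
      _ = _ := by rw [Real.exp_add]; ring

/-- Cauchy's estimate needs a bound on the closed unit disc about `w`. The sub-mean value inequality
provides it at each of those points from a further unit disc, hence the radius `2`. -/
theorem derivModulus_rpow_le (n : ℕ) {q : ℝ} (hq : 1 ≤ q) :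
    ∃ C : ℝ≥0∞, C ≠ ∞ ∧ ∀ f : ℂ → ℂ, Differentiable ℂ f → ∀ w,
      ENNReal.ofReal (derivModulus n f w) ^ q ≤
        C * ∫⁻ z in Metric.ball w 2, ENNReal.ofReal (gaussModulus f z) ^ q := by
  have hq0 : 0 < q := by linarith
  set C₁ : ℝ≥0∞ := ENNReal.ofReal (Real.exp (1 / 2)) ^ q / volume (Metric.ball (0 : ℂ) 1) with hC₁
  have hC₁t : C₁ ≠ ∞ := ENNReal.div_ne_top
    (ENNReal.rpow_ne_top_of_nonneg hq0.le ENNReal.ofReal_ne_top) volume_ball_one_ne_zero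
  have hC₁0 : C₁ ≠ 0 := by
    refine ENNReal.div_ne_zero.2 ⟨?_, volume_ball_ne_top 1⟩
    exact (ENNReal.rpow_pos (ENNReal.ofReal_pos.2 (Real.exp_pos _)) ENNReal.ofReal_ne_top).ne'
  set A : ℝ≥0∞ := ENNReal.ofReal (n.factorial * Real.exp (3 / 2)) with hA
  have hA0 : A ^ q ≠ 0 :=
    (ENNReal.rpow_pos (ENNReal.ofReal_pos.2 (by positivity)) ENNReal.ofReal_ne_top).ne'
  refine ⟨A ^ q * C₁, ENNReal.mul_ne_top
    (ENNReal.rpow_ne_top_of_nonneg hq0.le ENNReal.ofReal_ne_top) hC₁t, fun f hf w => ?_⟩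
  set I := ∫⁻ z in Metric.ball w 2, ENNReal.ofReal (gaussModulus f z) ^ q with hI
  by_cases hIt : I = ∞
  · rw [hIt, ENNReal.mul_top (mul_ne_zero hA0 hC₁0)]; exact le_top
  have hCI : C₁ * I ≠ ∞ := ENNReal.mul_ne_top hC₁t hIt
  have hloc : ∀ z ∈ Metric.closedBall w 1, gaussModulus f z ≤ ((C₁ * I) ^ (1 / q)).toReal := by
    intro z hz
    refine (ENNReal.ofReal_le_iff_le_toReal
      (ENNReal.rpow_ne_top_of_nonneg (by positivity) hCI)).1 ?_
    rw [one_div, ENNReal.le_rpow_inv_iff hq0]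
    refine (gaussModulus_rpow_le hf hq z).trans (mul_le_mul_right ?_ _)
    refine lintegral_mono_set (Metric.ball_subset_ball' ?_)
    have := Metric.mem_closedBall.1 hz
    linarith
  have h := derivModulus_le hf n w hloc
  calc ENNReal.ofReal (derivModulus n f w) ^ q
      ≤ ENNReal.ofReal (n.factorial * Real.exp (3 / 2) * ((C₁ * I) ^ (1 / q)).toReal) ^ q :=
        ENNReal.rpow_le_rpow (ENNReal.ofReal_le_ofReal h) hq0.le
    _ = A ^ q * C₁ * I := by
        rw [ENNReal.ofReal_mul (by positivity), ENNReal.ofReal_toReal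
          (ENNReal.rpow_ne_top_of_nonneg (by positivity) hCI), ENNReal.mul_rpow_of_nonneg _ _ hq0.le,
          ← ENNReal.rpow_mul, one_div, inv_mul_cancel₀ hq0.ne', ENNReal.rpow_one, mul_assoc]

theorem lintegral_setLIntegral_ball {F : ℂ → ℝ≥0∞} (hF : Measurable F) (r : ℝ) :
    ∫⁻ w, ∫⁻ z in Metric.ball w r, F z = volume (Metric.ball (0 : ℂ) r) * ∫⁻ z, F z := by
  rw [lintegral_congr fun w => (setLIntegral_ball_add w r F).symm,
    lintegral_lintegral_swap (by fun_prop)]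
  simp_rw [lintegral_add_left_eq_self F]
  simp [mul_comm]

/-- Integrating the local estimate over all centres counts every point with the area of a disc of
radius `2`, by Tonelli. -/
theorem lintegral_derivModulus_le (n : ℕ) {q : ℝ} (hq : 1 ≤ q) :
    ∃ C : ℝ≥0∞, C ≠ ∞ ∧ ∀ f : ℂ → ℂ, Differentiable ℂ f →
      ∫⁻ w, ENNReal.ofReal (derivModulus n f w) ^ q ≤
        C * ∫⁻ z, ENNReal.ofReal (gaussModulus f z) ^ q := by
  obtain ⟨C, hC, h⟩ := derivModulus_rpow_le n hq
  refine ⟨C * volume (Metric.ball (0 : ℂ) 2), ENNReal.mul_ne_top hC (volume_ball_ne_top 2),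
    fun f hf => (lintegral_mono (h f hf)).trans ?_⟩
  have := (continuous_gaussModulus hf.continuous).measurable
  rw [lintegral_const_mul' _ _ hC, lintegral_setLIntegral_ball (by fun_prop), mul_assoc]

/-! ### Fock and sampling norms through the weighted moduli. -/

theorem fockENorm_eq_lintegral {p : ℝ≥0∞} (hp : p ≠ ∞) (f : ℂ → ℂ) :
    fockENorm p f = (ENNReal.ofReal (p.toReal / (2 * Real.pi)) *
      ∫⁻ z, ENNReal.ofReal (gaussModulus f z) ^ p.toReal) ^ (1 / p.toReal) := by
  rw [fockENorm_of_ne_top hp]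
  congr 2
  refine lintegral_congr fun z => ?_
  rw [ENNReal.ofReal_rpow_of_nonneg (gaussModulus_nonneg _ _) ENNReal.toReal_nonneg, gaussModulus,
    Real.mul_rpow (norm_nonneg _) (Real.exp_pos _).le, ← Real.exp_mul]
  congr 3
  ring

theorem samplingENorm_top (n : ℕ) (S : Set ℂ) (f : ℂ → ℂ) :
    FockSpace.samplingENorm ∞ n S f = ⨆ z ∈ S, ENNReal.ofReal (derivModulus n f z) :=
  if_pos rfl

theorem samplingENorm_eq_lintegral {p : ℝ≥0∞} (hp : p ≠ ∞) (n : ℕ) (S : Set ℂ) (f : ℂ → ℂ) :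
    FockSpace.samplingENorm p n S f =
      (∫⁻ z in S, ENNReal.ofReal (derivModulus n f z) ^ p.toReal) ^ (1 / p.toReal) := by
  rw [FockSpace.samplingENorm, if_neg hp]
  congr 1
  refine lintegral_congr fun z => ?_
  have hz : 0 ≤ 1 + ‖z‖ := by positivity
  rw [ENNReal.ofReal_rpow_of_nonneg (derivModulus_nonneg _ _ _) ENNReal.toReal_nonneg, derivModulus,
    Real.mul_rpow (by positivity) (Real.exp_pos _).le, ← Real.exp_mul,
    Real.div_rpow (norm_nonneg _) (by positivity), ← Real.rpow_natCast (1 + ‖z‖) n, ← Real.rpow_mul hz]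
  congr 3
  ring

theorem one_le_toReal {p : ℝ≥0∞} (h1 : 1 ≤ p) (hp : p ≠ ∞) : 1 ≤ p.toReal := by
  rwa [← ENNReal.toReal_one, ENNReal.toReal_le_toReal ENNReal.one_ne_top hp]

/-- `∫ (|f| e^{-|z|²/2})^p dA` in terms of the Fock norm. -/
theorem lintegral_gaussModulus_eq {p : ℝ≥0∞} (h1 : 1 ≤ p) (hp : p ≠ ∞) (f : ℂ → ℂ) :
    ∫⁻ z, ENNReal.ofReal (gaussModulus f z) ^ p.toReal =
      ENNReal.ofReal (2 * Real.pi / p.toReal) * fockENorm p f ^ p.toReal := by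
  have hq := one_le_toReal h1 hp
  have hq0 : 0 < p.toReal := by linarith
  have hpi := Real.pi_pos
  rw [fockENorm_eq_lintegral hp, ← ENNReal.rpow_mul, one_div, inv_mul_cancel₀ hq0.ne',
    ENNReal.rpow_one, ← mul_assoc, ← ENNReal.ofReal_mul (by positivity)]
  have : 2 * Real.pi / p.toReal * (p.toReal / (2 * Real.pi)) = 1 := by field_simp
  rw [this, ENNReal.ofReal_one, one_mul]

theorem exists_gaussModulus_le (p : ℝ≥0∞) (h1 : 1 ≤ p) :
    ∃ C : ℝ, 0 < C ∧ ∀ f : ℂ → ℂ, Differentiable ℂ f → fockENorm p f ≠ ∞ →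
      ∀ w, gaussModulus f w ≤ C * (fockENorm p f).toReal := by
  by_cases hp : p = ∞
  · subst hp
    refine ⟨1, one_pos, fun f _ hfin w => ?_⟩
    rw [one_mul, ← ENNReal.ofReal_le_iff_le_toReal hfin, fockENorm_top]
    exact le_iSup (fun z : ℂ => ENNReal.ofReal (‖f z‖ * Real.exp (-‖z‖ ^ 2 / 2))) w
  · have hq := one_le_toReal h1 hp
    have hq0 : 0 < p.toReal := by linarith
    obtain ⟨K, hK⟩ : ∃ K, K = ENNReal.ofReal (Real.exp (1 / 2)) ^ p.toReal /
      volume (Metric.ball (0 : ℂ) 1) * ENNReal.ofReal (2 * Real.pi / p.toReal) := ⟨_, rfl⟩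
    have hKt : K ≠ ∞ := hK ▸ ENNReal.mul_ne_top (ENNReal.div_ne_top
      (ENNReal.rpow_ne_top_of_nonneg hq0.le ENNReal.ofReal_ne_top) volume_ball_one_ne_zero)
      ENNReal.ofReal_ne_top
    refine ⟨(K ^ (1 / p.toReal)).toReal + 1, by positivity, fun f hf hfin w => ?_⟩
    have h : ENNReal.ofReal (gaussModulus f w) ≤ K ^ (1 / p.toReal) * fockENorm p f := by
      have h2 : K ^ (1 / p.toReal) * fockENorm p f =
          (K * fockENorm p f ^ p.toReal) ^ (1 / p.toReal) := by
        rw [ENNReal.mul_rpow_of_nonneg _ _ (by positivity), ← ENNReal.rpow_mul, mul_one_div,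
          div_self hq0.ne', ENNReal.rpow_one]
      rw [h2, one_div, ENNReal.le_rpow_inv_iff hq0, hK, mul_assoc,
        ← lintegral_gaussModulus_eq h1 hp]
      exact (gaussModulus_rpow_le hf hq w).trans
        (mul_le_mul_right (setLIntegral_le_lintegral _ _) _)
    have hKt' : K ^ (1 / p.toReal) ≠ ∞ := ENNReal.rpow_ne_top_of_nonneg (by positivity) hKt
    have h3 := (ENNReal.ofReal_le_iff_le_toReal (ENNReal.mul_ne_top hKt' hfin)).1 h
    rw [ENNReal.toReal_mul] at h3
    refine h3.trans ?_
    gcongr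
    linarith

theorem exists_derivModulus_le (p : ℝ≥0∞) (h1 : 1 ≤ p) (n : ℕ) :
    ∃ C : ℝ, 0 < C ∧ ∀ f : ℂ → ℂ, Differentiable ℂ f → fockENorm p f ≠ ∞ →
      ∀ w, derivModulus n f w ≤ C * (fockENorm p f).toReal := by
  obtain ⟨C, hC, h⟩ := exists_gaussModulus_le p h1
  refine ⟨n.factorial * Real.exp (3 / 2) * C, by positivity, fun f hf hfin w => ?_⟩
  rw [mul_assoc]
  exact derivModulus_le hf n w fun z _ => h f hf hfin z

/-! ### Zeros, Jensen's formula and affine symbols. -/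

theorem countable_zeros {v : ℂ → ℂ} (hv : Differentiable ℂ v) (hv0 : v ≠ 0) :
    {z | v z = 0}.Countable := by
  obtain ⟨c, hc⟩ := Function.ne_iff.1 hv0
  have h := AnalyticOnNhd.preimage_zero_mem_codiscrete (f := v) (x := c)
    (fun z _ => hv.analyticAt z) hc
  have : DiscreteTopology {z | v z = 0} := by
    rw [← isDiscrete_iff_discreteTopology]
    have h2 := isDiscrete_of_codiscreteWithin (U := Set.univ) (s := {z | v z = 0})
      (by exact h)
    simpa using h2
  exact Set.countable_coe_iff.1 (TopologicalSpace.separableSpace_iff_countable.1 inferInstance)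

/-- The zeros have only countably many distances from `c`, while an interval of radii is
uncountable. Such a circle allows logarithms of `|v|` to be taken at all its points. -/
theorem exists_radius_forall_ne_zero {v : ℂ → ℂ} (hv : Differentiable ℂ v) (hv0 : v ≠ 0)
    (c : ℂ) (R : ℝ) : ∃ r, R ≤ r ∧ ∀ z, dist z c = r → v z ≠ 0 := by
  have h1 : ((fun z => dist z c) '' {z | v z = 0}).Countable := (countable_zeros hv hv0).image _
  have h2 : ¬ (Set.Icc R (R + 1)).Countable := by
    intro h
    have := h.measure_zero volume
    simp at this
  obtain ⟨r, hr, hr'⟩ := Set.not_subset.1 fun h => h2 (h1.mono h)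
  exact ⟨r, hr.1, fun z hz h0 => hr' ⟨z, h0, hz⟩⟩

/-- This is Cauchy's estimate with the mean over the circle in place of the supremum; growth of `ψ`
is only controlled in the mean. -/
theorem norm_iteratedDeriv_le_circleAverage {f : ℂ → ℂ} (hf : Differentiable ℂ f) (c : ℂ) {r : ℝ}
    (hr : 0 < r) (j : ℕ) :
    ‖iteratedDeriv j f c‖ * r ^ j ≤ j.factorial * Real.circleAverage (fun z => ‖f z‖) c r := by
  lift r to NNReal using hr.le
  have hs := (hf.hasFPowerSeriesOnBall c (R := r) (by exact_mod_cast hr)).factorial_smul 1 j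
  rw [iteratedFDeriv_apply_eq_iteratedDeriv_mul_prod, Finset.prod_const_one, one_smul] at hs
  have h1 := (cauchyPowerSeries f c r j).le_opNorm fun _ => (1 : ℂ)
  have h2 := norm_cauchyPowerSeries_le f c r j
  rw [← hs, nsmul_eq_mul, norm_mul, Complex.norm_natCast, mul_assoc, Real.circleAverage_def,
    smul_eq_mul]
  refine mul_le_mul_of_nonneg_left ?_ (Nat.cast_nonneg _)
  rw [← le_div_iff₀ (by positivity)]
  rw [NNReal.abs_eq, inv_pow, ← div_eq_mul_inv] at h2
  simpa using h1.trans (by simpa using h2)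

/-- In Jensen's formula every zero inside the disc contributes a nonnegative term. -/
theorem log_norm_le_circleAverage {v : ℂ → ℂ} (hv : Differentiable ℂ v) {c : ℂ} (hc : v c ≠ 0)
    {r : ℝ} (hr : 0 < r) :
    Real.log ‖v c‖ ≤ Real.circleAverage (fun z => Real.log ‖v z‖) c r := by
  have ha : AnalyticOnNhd ℂ v (Metric.closedBall c |r|) := fun z _ => hv.analyticAt z
  rw [ha.circleAverage_log_norm hr.ne' hc]
  refine le_add_of_nonneg_left (finsum_nonneg fun z => ?_)
  by_cases hz : z ∈ Metric.closedBall c |r|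
  · refine mul_nonneg (mod_cast MeromorphicOn.AnalyticOnNhd.divisor_nonneg ha z) ?_
    rw [mem_closedBall_iff_norm', abs_of_pos hr] at hz
    rcases eq_or_lt_of_le (norm_nonneg (c - z)) with h0 | h0
    · simp [← h0]
    · refine Real.log_nonneg ?_
      rw [← div_eq_mul_inv]
      exact (one_le_div h0).2 hz
  · simp [Function.locallyFinsuppWithin.apply_eq_zero_of_notMem _ hz]

/-- If `|v| e^{(|ψ|² - |z|²)/2}` is bounded for entire `v ≠ 0` and `ψ`, then `ψ` is affine. -/
theorem exists_affine_of_bounded {v ψ : ℂ → ℂ} (hv : Differentiable ℂ v) (hv0 : v ≠ 0)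
    (hψ : Differentiable ℂ ψ) {M : ℝ}
    (hM : ∀ z, ‖v z‖ * Real.exp ((‖ψ z‖ ^ 2 - ‖z‖ ^ 2) / 2) ≤ M) :
    ∃ a b : ℂ, ∀ z, ψ z = a * z + b := by
  obtain ⟨c, hc⟩ := Function.ne_iff.1 hv0
  have hc : v c ≠ 0 := hc
  have hMpos : 0 < M := lt_of_lt_of_le (by positivity) (hM c)
  have hm : ∀ r : ℝ, 0 < r → (∀ z, dist z c = r → v z ≠ 0) →
      Real.circleAverage (fun z => ‖ψ z‖) c r ^ 2 ≤
        (‖c‖ + r) ^ 2 + (2 * Real.log M - 2 * Real.log ‖v c‖) := by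
    intro r hr hne
    set m := Real.circleAverage (fun z => ‖ψ z‖) c r with hmdef
    have hψi : CircleIntegrable (fun z => ‖ψ z‖) c r :=
      hψ.continuous.norm.continuousOn.circleIntegrable'
    have hvi : CircleIntegrable (fun z => Real.log ‖v z‖) c r := by
      apply MeromorphicOn.circleIntegrable_log_norm
      exact fun z _ => (hv.analyticAt z).meromorphicAt
    have hmi : CircleIntegrable (fun z => m * ‖ψ z‖) c r := by
      simpa using! hψi.const_smul (a := m)
    -- Taking logarithms bounds `log|v| + |ψ|²/2`. The inequality `m|ψ| ≤ (m² + |ψ|²)/2` makes this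
    -- linear in `|ψ|`, so that averaging yields `m²` on the left and `m²/2` on the right.
    have hle : Real.circleAverage (fun z => Real.log ‖v z‖ + m * ‖ψ z‖) c r ≤
        (‖c‖ + r) ^ 2 / 2 + Real.log M + m ^ 2 / 2 := by
      refine Real.circleAverage_mono_on_of_le_circle (hvi.add hmi) fun z hz => ?_
      rw [mem_sphere_iff_norm, abs_of_pos hr] at hz
      have hvz : v z ≠ 0 := hne z (by rwa [dist_eq_norm])
      have h1 := Real.log_le_log (by positivity) (hM z)
      rw [Real.log_mul (by positivity) (by positivity), Real.log_exp] at h1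
      have h2 : ‖z‖ ≤ ‖c‖ + r := by
        have := norm_add_le c (z - c)
        rwa [add_sub_cancel, hz] at this
      have h3 : ‖z‖ ^ 2 ≤ (‖c‖ + r) ^ 2 := by gcongr
      nlinarith [sq_nonneg (m - ‖ψ z‖)]
    rw [Real.circleAverage_fun_add hvi hmi] at hle
    have hms : Real.circleAverage (fun z => m * ‖ψ z‖) c r = m * m := by
      simpa using Real.circleAverage_fun_smul (a := m) (f := fun z => ‖ψ z‖) (c := c) (R := r)
    have hlog := log_norm_le_circleAverage hv hc hr
    nlinarith
  have hder : ∀ j, 2 ≤ j → iteratedDeriv j ψ c = 0 := by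
    intro j hj
    by_contra hne
    set B := ‖iteratedDeriv j ψ c‖ / j.factorial with hB
    have hBpos : 0 < B := by positivity
    set K := 2 * Real.log M - 2 * Real.log ‖v c‖ with hK
    -- A nonzero Taylor coefficient of order `j ≥ 2` makes the mean of `|ψ|` at least `B r²`, while
    -- its square is only `O(r²)`. This lower bound on the radius makes the two incompatible; `r ≥
    -- 1` gives `r² ≥ r`.
    obtain ⟨r, hrR, hr⟩ := exists_radius_forall_ne_zero hv hv0 c
      (1 + ((‖c‖ + 1) ^ 2 + |K|) / B ^ 2)
    have hq : 0 ≤ ((‖c‖ + 1) ^ 2 + |K|) / B ^ 2 := by positivity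
    have hr1 : 1 ≤ r := by linarith
    have hr0 : 0 < r := by linarith
    have h1 := norm_iteratedDeriv_le_circleAverage hψ c hr0 j
    have h2 := hm r hr0 hr
    have h3 : B * r ^ 2 ≤ Real.circleAverage (fun z => ‖ψ z‖) c r := by
      calc B * r ^ 2 ≤ B * r ^ j := by gcongr
        _ ≤ _ := by
          rw [hB, div_mul_eq_mul_div, div_le_iff₀ (by positivity), mul_comm _ (j.factorial : ℝ)]
          exact h1
    have h4 : (B * r ^ 2) ^ 2 ≤ (‖c‖ + r) ^ 2 + K := (by gcongr : _ ≤ _).trans h2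
    have h5 : (‖c‖ + r) ^ 2 ≤ (‖c‖ + 1) ^ 2 * r ^ 2 := by
      rw [← mul_pow]
      gcongr
      nlinarith [norm_nonneg c]
    have h6 : K ≤ |K| * r ^ 2 := by
      have : 1 ≤ r ^ 2 := one_le_pow₀ hr1
      nlinarith [le_abs_self K, abs_nonneg K]
    have h7 : B ^ 2 * r ^ 2 ≤ (‖c‖ + 1) ^ 2 + |K| := by
      have : (B ^ 2 * r ^ 2) * r ^ 2 ≤ ((‖c‖ + 1) ^ 2 + |K|) * r ^ 2 := by nlinarith
      exact le_of_mul_le_mul_right this (by positivity)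
    have h8 : ((‖c‖ + 1) ^ 2 + |K|) / B ^ 2 < r ^ 2 := by nlinarith
    rw [div_lt_iff₀ (by positivity)] at h8
    linarith
  refine ⟨iteratedDeriv 1 ψ c, ψ c - iteratedDeriv 1 ψ c * c, fun z => ?_⟩
  have hs := Complex.hasSum_taylorSeries_of_entire hψ c z
  have hs2 := hasSum_sum_of_ne_finset_zero (L := .unconditional ℕ) (s := Finset.range 2)
    (f := fun n : ℕ => ((n.factorial : ℂ))⁻¹ • (z - c) ^ n • iteratedDeriv n ψ c) (by
      intro j hj
      have hj2 : 2 ≤ j := not_lt.1 fun h => hj (Finset.mem_range.2 h)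
      rw [hder j hj2]; simp)
  rw [hs.unique hs2]
  simp [Finset.sum_range_succ]
  ring

/-! ### Gaussian bounds, reproducing kernels and boundedness of the weight. -/

/-- The Gaussian `e^{-b|z|²}` has finite integral. -/
theorem lintegral_gaussian_ne_top {b : ℝ} (hb : 0 < b) :
    ∫⁻ z : ℂ, ENNReal.ofReal (Real.exp (-b * ‖z‖ ^ 2)) ≠ ∞ := by
  have hi : Integrable fun z : ℂ => Real.exp (-b * ‖z‖ ^ 2) := by
    refine Integrable.of_integral_ne_zero ?_
    rw [GaussianFourier.integral_rexp_neg_mul_sq_norm hb]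
    have := Real.pi_pos
    positivity
  have h := hi.lintegral_lt_top
  exact h.ne

theorem fockENorm_ne_top_of_le (p : ℝ≥0∞) (h1 : 1 ≤ p) {f : ℂ → ℂ} {C : ℝ} (hC : 0 ≤ C)
    (h : ∀ z, gaussModulus f z ≤ C * Real.exp (-(1 / 4) * ‖z‖ ^ 2)) : fockENorm p f ≠ ∞ := by
  by_cases hp : p = ∞
  · subst hp
    rw [fockENorm_top]
    refine ne_top_of_le_ne_top (ENNReal.ofReal_ne_top (r := C)) (iSup_le fun z =>
      ENNReal.ofReal_le_ofReal ((h z).trans ?_))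
    refine mul_le_of_le_one_right hC (Real.exp_le_one_iff.2 ?_)
    nlinarith [sq_nonneg ‖z‖]
  · have hq := one_le_toReal h1 hp
    have hq0 : 0 < p.toReal := by linarith
    rw [fockENorm_eq_lintegral hp]
    refine ENNReal.rpow_ne_top_of_nonneg (by positivity) (ENNReal.mul_ne_top ENNReal.ofReal_ne_top ?_)
    have hle : ∀ z, ENNReal.ofReal (gaussModulus f z) ^ p.toReal ≤ ENNReal.ofReal C ^ p.toReal *
        ENNReal.ofReal (Real.exp (-(p.toReal / 4) * ‖z‖ ^ 2)) := by
      intro z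
      have : Real.exp (-(p.toReal / 4) * ‖z‖ ^ 2) =
          Real.exp (-(1 / 4) * ‖z‖ ^ 2) ^ p.toReal := by
        rw [← Real.exp_mul]; congr 1; ring
      rw [this, ← ENNReal.ofReal_rpow_of_nonneg (Real.exp_pos _).le hq0.le,
        ← ENNReal.mul_rpow_of_nonneg _ _ hq0.le, ← ENNReal.ofReal_mul hC]
      exact ENNReal.rpow_le_rpow (ENNReal.ofReal_le_ofReal (h z)) hq0.le
    refine ne_top_of_le_ne_top ?_ (lintegral_mono hle)
    have hCt := ENNReal.rpow_ne_top_of_nonneg hq0.le (ENNReal.ofReal_ne_top (r := C))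
    rw [lintegral_const_mul' _ _ hCt]
    exact ENNReal.mul_ne_top hCt (lintegral_gaussian_ne_top (by positivity))

theorem fockENorm_pow_ne_top (p : ℝ≥0∞) (h1 : 1 ≤ p) (j : ℕ) :
    fockENorm p (fun z => z ^ j) ≠ ∞ := by
  refine fockENorm_ne_top_of_le p h1 (C := j.factorial * Real.exp 1) (by positivity) fun z => ?_
  have h := Real.pow_div_factorial_le_exp ‖z‖ (norm_nonneg z) j
  rw [div_le_iff₀ (by positivity)] at h
  calc gaussModulus (fun z => z ^ j) z = ‖z‖ ^ j * Real.exp (-‖z‖ ^ 2 / 2) := by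
        simp [gaussModulus]
    _ ≤ Real.exp ‖z‖ * j.factorial * Real.exp (-‖z‖ ^ 2 / 2) := by gcongr
    _ = j.factorial * Real.exp (‖z‖ - ‖z‖ ^ 2 / 2) := by
        rw [sub_eq_add_neg, Real.exp_add, neg_div]; ring
    -- Half of the Gaussian decay absorbs `e^{|z|}`: the gap is the square `(|z|/2 - 1)²`.
    _ ≤ j.factorial * Real.exp (1 + -(1 / 4) * ‖z‖ ^ 2) := by
        gcongr
        nlinarith [sq_nonneg (‖z‖ / 2 - 1)]
    _ = _ := by rw [Real.exp_add]; ring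

/-- The normalized reproducing kernel of the Fock space at `w`. -/
def fockKernel (w z : ℂ) : ℂ := (Real.exp (-‖w‖ ^ 2 / 2) : ℂ) * Complex.exp (starRingEnd ℂ w * z)

theorem differentiable_fockKernel (w : ℂ) : Differentiable ℂ (fockKernel w) := by
  unfold fockKernel; fun_prop

/-- Completing the square shows that the kernels are weighted translates of the constant `1`; hence
they all have the same norm. -/
theorem gaussModulus_fockKernel (w z : ℂ) :
    gaussModulus (fockKernel w) z = gaussModulus (fun _ => 1) (z - w) := by
  have h := norm_sq_add (z - w) w
  simp only [gaussModulus, fockKernel, norm_mul, Complex.norm_real, Complex.norm_exp,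
    Real.norm_of_nonneg (Real.exp_pos _).le, ← Real.exp_add, norm_one, one_mul]
  congr 1
  rw [sub_add_cancel, mul_sub, Complex.sub_re, ← Complex.normSq_eq_conj_mul_self,
    Complex.ofReal_re, Complex.normSq_eq_norm_sq] at h
  linarith

theorem fockENorm_fockKernel {p : ℝ≥0∞} (w : ℂ) :
    fockENorm p (fockKernel w) = fockENorm p (fun _ => 1) := by
  by_cases hp : p = ∞
  · subst hp
    simp only [fockENorm_top]
    change ⨆ z, ENNReal.ofReal (gaussModulus (fockKernel w) z) =
      ⨆ z, ENNReal.ofReal (gaussModulus (fun _ => 1) z)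
    simp only [gaussModulus_fockKernel]
    exact (Equiv.subRight w).iSup_comp (g := fun z => ENNReal.ofReal (gaussModulus (fun _ => 1) z))
  · simp only [fockENorm_eq_lintegral hp, gaussModulus_fockKernel]
    rw [lintegral_sub_right_eq_self (fun z => ENNReal.ofReal (gaussModulus (fun _ => 1) z) ^ p.toReal)]

theorem iteratedDeriv_fockKernel (w : ℂ) (n : ℕ) (z : ℂ) :
    iteratedDeriv n (fockKernel w) z = starRingEnd ℂ w ^ n * fockKernel w z := by
  unfold fockKernel
  rw [iteratedDeriv_const_mul_field, iteratedDeriv_cexp_const_mul]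
  ring

variable {p : ℝ≥0∞} [Fact (1 ≤ p)]

/-- The image of the kernel centred at `ψ z` has weighted modulus exactly `weightL` at `z`, and
point evaluations are bounded by the norm. -/
theorem exists_weightL_le {u ψ : ℂ → ℂ} {n : ℕ} (hD : IsBoundedOnFock p u ψ n) :
    ∃ M : ℝ, 0 < M ∧ ∀ z, weightL u ψ n z ≤ M := by
  obtain ⟨T, hT⟩ := hD
  have h1 : 1 ≤ p := Fact.out
  obtain ⟨C, hC, hle⟩ := exists_gaussModulus_le p h1
  have hone : fockENorm p (fun _ => 1) ≠ ∞ := by simpa using fockENorm_pow_ne_top p h1 0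
  refine ⟨C * (‖T‖ * (fockENorm p (fun _ => 1)).toReal) + 1, by positivity, fun z => ?_⟩
  let k : FockSpace p := ⟨fockKernel (ψ z), differentiable_fockKernel _, by
    rw [fockENorm_fockKernel]; exact hone.lt_top⟩
  have hk : ‖k‖ = (fockENorm p (fun _ => 1)).toReal := by
    rw [FockSpace.norm_def]
    change (fockENorm p (fockKernel (ψ z))).toReal = _
    rw [fockENorm_fockKernel]
  have h2 := hle (T k).1 (T k).2.1 (T k).2.2.ne z
  have h3 : gaussModulus (T k).1 z = weightL u ψ n z := by
    have hTk : (T k).1 = weightedCompDiff u ψ n (fockKernel (ψ z)) := hT k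
    rw [hTk]
    simp only [gaussModulus, weightedCompDiff, weightL, iteratedDeriv_fockKernel, fockKernel,
      norm_mul, norm_pow, RCLike.norm_conj, Complex.norm_real, Complex.norm_exp,
      Real.norm_of_nonneg (Real.exp_pos _).le]
    rw [← Complex.normSq_eq_conj_mul_self, Complex.ofReal_re, Complex.normSq_eq_norm_sq,
      ← Real.exp_add, mul_assoc, mul_assoc, mul_assoc, ← Real.exp_add]
    congr 3
    ring
  rw [h3] at h2
  have h4 := T.le_opNorm k
  rw [hk] at h4
  have h5 : C * (fockENorm p (T k).1).toReal ≤ C * (‖T‖ * (fockENorm p (fun _ => 1)).toReal) :=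
    mul_le_mul_of_nonneg_left h4 hC.le
  linarith

theorem mul_pow_ne_zero {u ψ : ℂ → ℂ} (hu : Differentiable ℂ u) (hψ : Differentiable ℂ ψ)
    (hu0 : u ≠ 0) (hψc : ¬ ∃ c : ℂ, ∀ z, ψ z = c) (n : ℕ) : (fun z => u z * ψ z ^ n) ≠ 0 := by
  intro h
  rcases AnalyticOnNhd.eq_zero_or_eq_zero_of_smul_eq_zero (U := Set.univ) (f := u)
    (g := fun z => ψ z ^ n) (fun z _ => hu.analyticAt z) (fun z _ => (hψ.pow n).analyticAt z)
    (fun z _ => congrFun h z) isPreconnected_univ with h1 | h1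
  · exact hu0 (funext fun z => h1 z trivial)
  · exact hψc ⟨0, fun z => eq_zero_of_pow_eq_zero (h1 z trivial)⟩

theorem exists_affine {u ψ : ℂ → ℂ} {n : ℕ} (hu : Differentiable ℂ u) (hψ : Differentiable ℂ ψ)
    (hu0 : u ≠ 0) (hψc : ¬ ∃ c : ℂ, ∀ z, ψ z = c) (hD : IsBoundedOnFock p u ψ n) :
    ∃ a b : ℂ, a ≠ 0 ∧ ∀ z, ψ z = a * z + b := by
  obtain ⟨M, -, hM⟩ := exists_weightL_le hD
  obtain ⟨a, b, hab⟩ := exists_affine_of_bounded (v := fun z => u z * ψ z ^ n)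
    (hu.mul (hψ.pow n)) (mul_pow_ne_zero hu hψ hu0 hψc n) hψ (M := M)
    (fun z => by simpa [weightL] using hM z)
  refine ⟨a, b, ?_, hab⟩
  rintro rfl
  exact hψc ⟨b, fun z => by simp [hab]⟩

/-! ### Completeness of the Fock space. -/

/-- Fatou's lemma for finite `p`; for `p = ∞` the bound passes to the limit at each point. -/
theorem fockENorm_le_of_tendsto {p : ℝ≥0∞} (h1 : 1 ≤ p) {F : ℕ → ℂ → ℂ} {G : ℂ → ℂ}
    (hF : ∀ k, Continuous (F k)) (hlim : ∀ z, Tendsto (fun k => F k z) atTop (𝓝 (G z)))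
    {B : ℝ≥0∞} (hB : ∀ᶠ k in atTop, fockENorm p (F k) ≤ B) : fockENorm p G ≤ B := by
  by_cases hp : p = ∞
  · subst hp
    simp only [fockENorm_top] at hB ⊢
    refine iSup_le fun z => ?_
    refine le_of_tendsto (ENNReal.tendsto_ofReal (((hlim z).norm).mul_const _)) ?_
    filter_upwards [hB] with k hk
    exact (le_iSup (fun z : ℂ => ENNReal.ofReal (‖F k z‖ * Real.exp (-‖z‖ ^ 2 / 2))) z).trans hk
  · simp only [fockENorm_eq_eLpNorm h1 hp] at hB ⊢
    refine (Lp.eLpNorm_lim_le_liminf_eLpNorm (f := fun k z => F k z * (Real.exp (-‖z‖ ^ 2 / 2) : ℂ))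
      (fun k => Continuous.aestronglyMeasurable ((hF k).mul (by fun_prop))) _
      (ae_of_all _ fun z => (hlim z).mul_const _)).trans ?_
    exact liminf_le_of_frequently_le' hB.frequently

namespace FockSpace

theorem exists_norm_apply_le (p : ℝ≥0∞) [Fact (1 ≤ p)] :
    ∃ C : ℝ, 0 < C ∧ ∀ (f : FockSpace p) (z : ℂ),
      ‖f.1 z‖ ≤ C * Real.exp (‖z‖ ^ 2 / 2) * ‖f‖ := by
  obtain ⟨C, hC, h⟩ := exists_gaussModulus_le p Fact.out
  refine ⟨C, hC, fun f z => ?_⟩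
  have h2 := h f.1 f.2.1 f.2.2.ne z
  have : ‖f.1 z‖ = gaussModulus f.1 z * Real.exp (‖z‖ ^ 2 / 2) := by
    rw [gaussModulus, mul_assoc, ← Real.exp_add, neg_div, neg_add_cancel, Real.exp_zero, mul_one]
  rw [this, norm_def, mul_right_comm]
  gcongr

/-- Norm-Cauchy sequences are locally uniformly Cauchy by the pointwise bound, so the limit is
entire. Fatou applied to the differences upgrades this to convergence in norm. -/
instance : CompleteSpace (FockSpace p) := by
  refine Metric.complete_of_cauchySeq_tendsto fun f hf => ?_
  obtain ⟨C, hC, hpt⟩ := exists_norm_apply_le p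
  rw [Metric.cauchySeq_iff] at hf
  have hsub : ∀ m k z, ‖(f m).1 z - (f k).1 z‖ ≤ C * Real.exp (‖z‖ ^ 2 / 2) * ‖f m - f k‖ :=
    fun m k z => hpt (f m - f k) z
  have hlim : ∀ z, ∃ y, Tendsto (fun k => (f k).1 z) atTop (𝓝 y) := by
    intro z
    refine cauchySeq_tendsto_of_complete (Metric.cauchySeq_iff.2 fun ε hε => ?_)
    obtain ⟨N, hN⟩ := hf (ε / (C * Real.exp (‖z‖ ^ 2 / 2))) (by positivity)
    refine ⟨N, fun m hm k hk => ?_⟩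
    have := hN m hm k hk
    rw [dist_eq_norm, lt_div_iff₀ (by positivity), mul_comm] at this
    rw [dist_eq_norm]
    exact (hsub m k z).trans_lt this
  choose g hg using hlim
  have hgu : ∀ m z (e : ℝ), (∀ᶠ k in atTop, ‖f m - f k‖ ≤ e) →
      ‖(f m).1 z - g z‖ ≤ C * Real.exp (‖z‖ ^ 2 / 2) * e := by
    intro m z e he
    refine le_of_tendsto ((tendsto_const_nhds.sub (hg z)).norm) ?_
    filter_upwards [he] with k hk
    exact (hsub m k z).trans (by gcongr)
  have hloc : TendstoLocallyUniformlyOn (fun k => (f k).1) g atTop Set.univ := by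
    rw [tendstoLocallyUniformlyOn_iff_forall_isCompact isOpen_univ]
    intro K _ hK
    obtain ⟨R, hR⟩ := hK.isBounded.exists_norm_le
    rw [Metric.tendstoUniformlyOn_iff]
    intro ε hε
    obtain ⟨N, hN⟩ := hf (ε / (C * Real.exp (R ^ 2 / 2)) / 2) (by positivity)
    filter_upwards [eventually_ge_atTop N] with m hm z hz
    have h1 := hgu m z (ε / (C * Real.exp (R ^ 2 / 2)) / 2) (by
      filter_upwards [eventually_ge_atTop N] with k hk
      rw [← dist_eq_norm]
      exact (hN m hm k hk).le)
    rw [dist_comm, dist_eq_norm]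
    refine h1.trans_lt ?_
    have hzR : ‖z‖ ^ 2 ≤ R ^ 2 := by gcongr; exact hR z hz
    calc C * Real.exp (‖z‖ ^ 2 / 2) * (ε / (C * Real.exp (R ^ 2 / 2)) / 2)
        ≤ C * Real.exp (R ^ 2 / 2) * (ε / (C * Real.exp (R ^ 2 / 2)) / 2) := by gcongr
      _ = ε / 2 := by field_simp
      _ < ε := by linarith
  have hgd : Differentiable ℂ g := by
    rw [← differentiableOn_univ]
    exact hloc.differentiableOn
      (Eventually.of_forall fun k => (f k).2.1.differentiableOn) isOpen_univ
  have hfat : ∀ ε : ℝ, 0 < ε → ∃ N, ∀ m ≥ N, fockENorm p ((f m).1 - g) ≤ ENNReal.ofReal ε := by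
    intro ε hε
    obtain ⟨N, hN⟩ := hf ε hε
    refine ⟨N, fun m hm => ?_⟩
    refine fockENorm_le_of_tendsto (F := fun k => (f m).1 - (f k).1) Fact.out
      (fun k => (f m).2.1.continuous.sub (f k).2.1.continuous)
      (fun z => tendsto_const_nhds.sub (hg z)) ?_
    filter_upwards [eventually_ge_atTop N] with k hk
    have h := (hN m hm k hk).le
    rw [dist_eq_norm, norm_def] at h
    exact ENNReal.le_ofReal_iff_toReal_le (f m - f k).2.2.ne hε.le |>.2 h
  obtain ⟨N, hN⟩ := hfat 1 one_pos
  have hdiff : (f N).1 - g ∈ fockSubmodule p :=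
    ⟨(f N).2.1.sub hgd, (hN N le_rfl).trans_lt ENNReal.ofReal_lt_top⟩
  have hgm : g ∈ fockSubmodule p := by
    have := (fockSubmodule p).sub_mem (f N).2 hdiff
    rwa [sub_sub_cancel] at this
  obtain ⟨G, rfl⟩ : ∃ G : FockSpace p, G.1 = g := ⟨⟨g, hgm⟩, rfl⟩
  refine ⟨G, Metric.tendsto_atTop.2 fun ε hε => ?_⟩
  obtain ⟨N, hN⟩ := hfat (ε / 2) (by positivity)
  refine ⟨N, fun m hm => ?_⟩
  rw [dist_eq_norm, norm_def]
  refine lt_of_le_of_lt (ENNReal.toReal_le_of_le_ofReal (by positivity) (hN m hm)) (by linarith)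

/-! ### Functions vanishing to order `n` at the origin. -/

/-- The functional `f ↦ f^{(n)}(w)` on the Fock space. -/
def iteratedDerivₗ (p : ℝ≥0∞) [Fact (1 ≤ p)] (n : ℕ) (w : ℂ) : FockSpace p →ₗ[ℂ] ℂ where
  toFun f := iteratedDeriv n f.1 w
  map_add' f g := iteratedDeriv_add f.2.1.contDiff.contDiffAt g.2.1.contDiff.contDiffAt
  map_smul' c f := iteratedDeriv_const_smul f.2.1.contDiff.contDiffAt c

theorem continuous_iteratedDerivₗ (n : ℕ) : Continuous (iteratedDerivₗ p n 0) := by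
  obtain ⟨C, -, h⟩ := exists_derivModulus_le p Fact.out n
  refine AddMonoidHomClass.continuous_of_bound (iteratedDerivₗ p n 0) C fun f => ?_
  simpa [derivModulus] using! h f.1 f.2.1 f.2.2.ne 0

/-- The functions vanishing to order `n` at the origin, as a subspace. -/
def vanishingSubmodule (p : ℝ≥0∞) [Fact (1 ≤ p)] (n : ℕ) : Submodule ℂ (FockSpace p) :=
  ⨅ j : Fin n, (iteratedDerivₗ p j 0).ker

theorem mem_vanishingSubmodule {n : ℕ} {f : FockSpace p} :
    f ∈ vanishingSubmodule p n ↔ f ∈ vanishing p n := by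
  simp only [vanishingSubmodule, Submodule.mem_iInf, LinearMap.mem_ker]
  exact ⟨fun h j hj => h ⟨j, hj⟩, fun h j => h j j.2⟩

theorem isClosed_vanishingSubmodule (n : ℕ) :
    IsClosed (vanishingSubmodule p n : Set (FockSpace p)) := by
  rw [vanishingSubmodule, Submodule.coe_iInf]
  exact isClosed_iInter fun j => isClosed_singleton.preimage (continuous_iteratedDerivₗ (j : ℕ))

/-- The monomial `z ↦ z ^ j` in the Fock space. -/
def monomial (p : ℝ≥0∞) [Fact (1 ≤ p)] (j : ℕ) : FockSpace p :=
  ⟨fun z => z ^ j, differentiable_id.pow j, (fockENorm_pow_ne_top p Fact.out j).lt_top⟩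

theorem iteratedDerivₗ_monomial (n j : ℕ) (w : ℂ) :
    iteratedDerivₗ p n w (monomial p j) = j.descFactorial n * w ^ (j - n) := by
  change iteratedDeriv n (fun z : ℂ => z ^ j) w = _
  simp

/-- Subtract the Taylor polynomial of degree below `n`, which the `n`-th derivative annihilates. -/
theorem exists_mem_vanishing (n : ℕ) (f : FockSpace p) :
    ∃ g ∈ vanishing p n, ∀ w, iteratedDeriv n g.1 w = iteratedDeriv n f.1 w := by
  set P : FockSpace p :=
    ∑ j ∈ Finset.range n, (iteratedDeriv j f.1 0 / j.factorial) • monomial p j with hP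
  refine ⟨f - P, fun k hk => ?_, fun w => ?_⟩
  · change iteratedDerivₗ p k 0 (f - P) = 0
    rw [map_sub, hP, map_sum, Finset.sum_eq_single k]
    · rw [map_smul, iteratedDerivₗ_monomial, Nat.descFactorial_self, Nat.sub_self, pow_zero,
        mul_one, smul_eq_mul, div_mul_cancel₀ _ (by exact_mod_cast k.factorial_ne_zero)]
      exact sub_self _
    · intro j _ hjk
      rw [map_smul, iteratedDerivₗ_monomial]
      rcases lt_or_gt_of_ne hjk with h | h
      · simp [Nat.descFactorial_of_lt h]
      · simp [zero_pow (Nat.sub_ne_zero_of_lt h)]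
    · simp [hk]
  · change iteratedDerivₗ p n w (f - P) = iteratedDerivₗ p n w f
    rw [map_sub, hP, map_sum, Finset.sum_eq_zero, sub_zero]
    intro j hj
    rw [map_smul, iteratedDerivₗ_monomial, Nat.descFactorial_of_lt (Finset.mem_range.1 hj)]
    simp

theorem eq_zero_of_vanishing {n : ℕ} {f : FockSpace p} (hf : f ∈ vanishing p n)
    (h : ∀ w, iteratedDeriv n f.1 w = 0) : f = 0 := by
  refine Subtype.ext (funext fun z => ?_)
  have hall : ∀ j, iteratedDeriv j f.1 0 = 0 := by
    intro j
    rcases lt_or_ge j n with hj | hj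
    · exact hf j hj
    · obtain ⟨k, rfl⟩ := Nat.exists_eq_add_of_le hj
      have h0 : iteratedDeriv n f.1 = fun _ => 0 := funext h
      rw [add_comm, iteratedDeriv_eq_iterate, Function.iterate_add_apply,
        ← iteratedDeriv_eq_iterate, ← iteratedDeriv_eq_iterate, h0]
      simp
  have hs := Complex.hasSum_taylorSeries_of_entire f.2.1 0 z
  simp only [hall, smul_zero] at hs
  exact hs.unique hasSum_zero

end FockSpace

/-! ### Closed range and lower bounds. -/

open FockSpace in
/-- The operator has closed range exactly if it is bounded below on the functions vanishing to
order `n` at the origin. -/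
theorem isClosed_rangeOnFock_iff {u ψ : ℂ → ℂ} {n : ℕ} (hu : Differentiable ℂ u) (hu0 : u ≠ 0)
    {a b : ℂ} (ha : a ≠ 0) (hψ : ∀ z, ψ z = a * z + b) {T : FockSpace p →L[ℂ] FockSpace p}
    (hT : ∀ f : FockSpace p, T f = weightedCompDiff u ψ n f) :
    IsClosed (rangeOnFock p u ψ n) ↔
      ∃ c : ℝ, 0 < c ∧ ∀ f ∈ vanishing p n, c * ‖f‖ ≤ ‖T f‖ := by
  set V := vanishingSubmodule p n with hV
  have : CompleteSpace V := (isClosed_vanishingSubmodule n).completeSpace_coe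
  set S : V →L[ℂ] FockSpace p := T.comp V.subtypeL with hS
  have hrange : rangeOnFock p u ψ n = Set.range S := by
    ext g
    constructor
    · rintro ⟨f, hf⟩
      obtain ⟨f₀, hf₀, hd⟩ := exists_mem_vanishing n f
      refine ⟨⟨f₀, mem_vanishingSubmodule.2 hf₀⟩, Subtype.ext ?_⟩
      change (T f₀).1 = g.1
      rw [show (T f₀).1 = _ from hT f₀, show g.1 = _ from hf]
      funext z
      simp only [weightedCompDiff, hd]
    · rintro ⟨f, rfl⟩
      exact ⟨f.1, hT f.1⟩
  have hinj : Function.Injective S := by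
    refine (injective_iff_map_eq_zero S).2 fun f hf => ?_
    have hz : ∀ z, u z * iteratedDeriv n f.1.1 (ψ z) = 0 := fun z => by
      have h1 := congrFun (hT f.1) z
      have h2 : T f.1 = 0 := hf
      rw [h2] at h1
      exact h1.symm
    have hψd : Differentiable ℂ ψ := by
      rw [show ψ = fun z => a * z + b from funext hψ]; fun_prop
    have hd : Differentiable ℂ fun z => iteratedDeriv n f.1.1 (ψ z) :=
      (differentiable_iteratedDeriv f.1.2.1 n).comp hψd
    refine Subtype.ext (eq_zero_of_vanishing (mem_vanishingSubmodule.1 f.2) fun w => ?_)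
    -- Entire functions have no zero divisors, and `ψ` is onto, so the `n`-th derivative vanishes
    -- everywhere.
    rcases AnalyticOnNhd.eq_zero_or_eq_zero_of_smul_eq_zero (U := Set.univ) (f := u)
      (g := fun z => iteratedDeriv n f.1.1 (ψ z)) (fun z _ => hu.analyticAt z)
      (fun z _ => hd.analyticAt z) (fun z _ => hz z) isPreconnected_univ with h | h
    · exact absurd (funext fun z => h z trivial) hu0
    · have := h ((w - b) / a) trivial
      simpa [hψ, mul_div_cancel₀ _ ha] using this
  rw [hrange]
  constructor
  · intro hcl
    -- The open mapping theorem enters here, with both spaces complete. `K` may be zero, so the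
    -- lower bound uses `K + 1`.
    obtain ⟨K, hK⟩ := S.antilipschitz_of_injective_of_isClosed_range hinj hcl
    refine ⟨((K : ℝ) + 1)⁻¹, by positivity, fun f hf => ?_⟩
    have h := hK.le_mul_dist ⟨f, mem_vanishingSubmodule.2 hf⟩ 0
    rw [map_zero, dist_zero_right, dist_zero_right] at h
    change ‖f‖ ≤ K * ‖T f‖ at h
    rw [inv_mul_le_iff₀ (by positivity)]
    nlinarith [norm_nonneg (T f)]
  · rintro ⟨c, hc, h⟩
    have hA : AntilipschitzWith (c⁻¹).toNNReal S := by
      refine S.antilipschitz_of_bound fun f => ?_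
      rw [Real.coe_toNNReal _ (by positivity), ← div_eq_inv_mul, le_div_iff₀ hc, mul_comm]
      exact h f.1 (mem_vanishingSubmodule.1 f.2)
    exact hA.isClosed_range S.uniformContinuous

/-! ### The amplitude and affine changes of variable. -/

/-- The factor relating `D_{(u,ψ,n)} f` at `z` to the `n`-th derivative of `f` at `ψ z`, both with
their weights. -/
def weightAmplitude (u ψ : ℂ → ℂ) (n : ℕ) (z : ℂ) : ℝ :=
  ‖u z‖ * (1 + ‖ψ z‖) ^ n * Real.exp ((‖ψ z‖ ^ 2 - ‖z‖ ^ 2) / 2)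

theorem gaussModulus_weightedCompDiff (u ψ : ℂ → ℂ) (n : ℕ) (f : ℂ → ℂ) (z : ℂ) :
    gaussModulus (weightedCompDiff u ψ n f) z =
      weightAmplitude u ψ n z * derivModulus n f (ψ z) := by
  have h : Real.exp (-‖z‖ ^ 2 / 2) =
      Real.exp ((‖ψ z‖ ^ 2 - ‖z‖ ^ 2) / 2) * Real.exp (-‖ψ z‖ ^ 2 / 2) := by
    rw [← Real.exp_add]; congr 1; ring
  have h1 : (1 + ‖ψ z‖) ^ n ≠ 0 := by positivity
  rw [gaussModulus, weightedCompDiff, weightAmplitude, derivModulus, norm_mul, h]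
  field_simp

theorem weightL_le_weightAmplitude (u ψ : ℂ → ℂ) (n : ℕ) (z : ℂ) :
    weightL u ψ n z ≤ weightAmplitude u ψ n z := by
  unfold weightL weightAmplitude
  gcongr
  linarith

theorem weightAmplitude_le (u ψ : ℂ → ℂ) (n : ℕ) {z : ℂ} (hz : 1 ≤ ‖ψ z‖) :
    weightAmplitude u ψ n z ≤ 2 ^ n * weightL u ψ n z := by
  unfold weightL weightAmplitude
  calc ‖u z‖ * (1 + ‖ψ z‖) ^ n * Real.exp ((‖ψ z‖ ^ 2 - ‖z‖ ^ 2) / 2)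
      ≤ ‖u z‖ * (2 * ‖ψ z‖) ^ n * Real.exp ((‖ψ z‖ ^ 2 - ‖z‖ ^ 2) / 2) := by
        gcongr; linarith
    _ = _ := by rw [mul_pow]; ring

theorem continuous_weightL {u ψ : ℂ → ℂ} (hu : Continuous u) (hψ : Continuous ψ) (n : ℕ) :
    Continuous (weightL u ψ n) := by
  unfold weightL; fun_prop

theorem continuous_weightAmplitude {u ψ : ℂ → ℂ} (hu : Continuous u) (hψ : Continuous ψ) (n : ℕ) :
    Continuous (weightAmplitude u ψ n) := by
  unfold weightAmplitude; fun_prop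

/-- A linear automorphism carries Haar measure to Haar measure, and translations preserve it. The
value of the factor is irrelevant; only that it is nonzero and finite matters. -/
theorem exists_map_affineHomeomorph {a : ℂ} (ha : a ≠ 0) (b : ℂ) :
    ∃ κ : ℝ≥0∞, κ ≠ 0 ∧ κ ≠ ∞ ∧
      Measure.map (affineHomeomorph a b ha) volume = κ • (volume : Measure ℂ) := by
  have h1 : (Measure.map (Homeomorph.mulLeft₀ a ha) (volume : Measure ℂ)).IsAddHaarMeasure := by
    refine AddEquiv.isAddHaarMeasure_map volume
      (LinearEquiv.smulOfNeZero ℂ ℂ a ha).toAddEquiv ?_ ?_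
    · exact continuous_const_smul a
    · exact (Homeomorph.mulLeft₀ a ha).symm.continuous
  have h := Measure.isAddLeftInvariant_eq_smul
    (Measure.map (Homeomorph.mulLeft₀ a ha) (volume : Measure ℂ)) volume
  refine ⟨Measure.addHaarScalarFactor (Measure.map (Homeomorph.mulLeft₀ a ha) volume) volume,
    ENNReal.coe_ne_zero.2 (Measure.addHaarScalarFactor_pos_of_isAddHaarMeasure _ _).ne',
    ENNReal.coe_ne_top, ?_⟩
  have h2 : Measure.map (affineHomeomorph a b ha) (volume : Measure ℂ) =
      Measure.map (fun z => z + b) (Measure.map (Homeomorph.mulLeft₀ a ha) volume) := by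
    rw [Measure.map_map (by fun_prop) (Homeomorph.measurable _)]
    rfl
  rw [h2]
  conv_lhs => rw [h]
  rw [Measure.map_smul, map_add_right_eq_self]
  rfl

theorem exists_setLIntegral_comp_affine {a : ℂ} (ha : a ≠ 0) (b : ℂ) :
    ∃ κ : ℝ≥0∞, κ ≠ 0 ∧ κ ≠ ∞ ∧ ∀ (A : Set ℂ) (F : ℂ → ℝ≥0∞),
      ∫⁻ z in A, F (affineHomeomorph a b ha z) = κ * ∫⁻ w in affineHomeomorph a b ha '' A, F w := by
  obtain ⟨κ, h0, ht, h⟩ := exists_map_affineHomeomorph ha b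
  refine ⟨κ, h0, ht, fun A F => ?_⟩
  have he := (affineHomeomorph a b ha).measurableEmbedding
  rw [← smul_eq_mul, ← lintegral_smul_measure, ← Measure.restrict_smul, ← h, he.restrict_map,
    he.lintegral_map, (affineHomeomorph a b ha).preimage_image]

section Affine

variable {p : ℝ≥0∞} [Fact (1 ≤ p)] {u : ℂ → ℂ} {n : ℕ} {a b : ℂ}

/-- Where `|ψ| ≥ 1` the bound on `weightL` suffices; the rest is compact and the amplitude is
continuous. -/
theorem exists_weightAmplitude_le (hu : Continuous u) (ha : a ≠ 0)
    (hD : IsBoundedOnFock p u (affineHomeomorph a b ha) n) :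
    ∃ K : ℝ, 0 < K ∧ ∀ z, weightAmplitude u (affineHomeomorph a b ha) n z ≤ K := by
  obtain ⟨M, hM, hL⟩ := exists_weightL_le hD
  have hc : IsCompact (affineHomeomorph a b ha ⁻¹' Metric.closedBall 0 1) :=
    (affineHomeomorph a b ha).isCompact_preimage.2 (isCompact_closedBall 0 1)
  obtain ⟨K, hK⟩ := hc.exists_bound_of_continuousOn
    (continuous_weightAmplitude hu (affineHomeomorph a b ha).continuous n).continuousOn
  refine ⟨max (2 ^ n * M) K, lt_max_of_lt_left (by positivity), fun z => ?_⟩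
  rcases le_total 1 ‖affineHomeomorph a b ha z‖ with hz | hz
  · refine le_max_of_le_left ((weightAmplitude_le u _ n hz).trans ?_)
    gcongr
    exact hL z
  · exact le_max_of_le_right ((le_abs_self _).trans (hK z (by simpa using hz)))

/-! ### Sampling inequalities against lower bounds. -/

theorem exists_samplingENorm_le (ha : a ≠ 0) {T : FockSpace p →L[ℂ] FockSpace p}
    (hT : ∀ f : FockSpace p, T f = weightedCompDiff u (affineHomeomorph a b ha) n f) {ε : ℝ}
    (hε : 0 < ε) :
    ∃ C : ℝ, 0 < C ∧ ∀ f : FockSpace p, FockSpace.samplingENorm p n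
      (affineHomeomorph a b ha '' {z | ε < weightL u (affineHomeomorph a b ha) n z}) f.1 ≤
        ENNReal.ofReal (C * ‖T f‖) := by
  set ψ := affineHomeomorph a b ha with hψ
  have h1 : 1 ≤ p := Fact.out
  have hgm : ∀ (f : FockSpace p) z, gaussModulus (T f).1 z =
      weightAmplitude u ψ n z * derivModulus n f.1 (ψ z) := fun f z => by
    rw [show (T f).1 = _ from hT f, gaussModulus_weightedCompDiff]
  have hpt : ∀ (f : FockSpace p) z, ε < weightL u ψ n z →
      derivModulus n f.1 (ψ z) ≤ ε⁻¹ * gaussModulus (T f).1 z := by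
    intro f z hz
    rw [hgm, ← div_eq_inv_mul, le_div_iff₀ hε, mul_comm]
    exact mul_le_mul_of_nonneg_right (hz.le.trans (weightL_le_weightAmplitude _ _ _ _))
      (derivModulus_nonneg _ _ _)
  by_cases hp : p = ∞
  · subst hp
    obtain ⟨C, hC, h⟩ := exists_gaussModulus_le ∞ h1
    refine ⟨ε⁻¹ * C, by positivity, fun f => ?_⟩
    rw [samplingENorm_top]
    refine iSup₂_le fun w hw => ?_
    obtain ⟨z, hz, rfl⟩ := hw
    refine ENNReal.ofReal_le_ofReal ((hpt f z hz).trans ?_)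
    rw [mul_assoc]
    exact mul_le_mul_of_nonneg_left (h _ (T f).2.1 (T f).2.2.ne z) (by positivity)
  · have hq := one_le_toReal h1 hp
    have hq0 : 0 < p.toReal := by linarith
    obtain ⟨κ, hκ0, hκt, hκ⟩ := exists_setLIntegral_comp_affine ha b
    obtain ⟨D, hD⟩ : ∃ D, D = κ⁻¹ * (ENNReal.ofReal ε⁻¹ ^ p.toReal *
      ENNReal.ofReal (2 * Real.pi / p.toReal)) := ⟨_, rfl⟩
    have hεt : ENNReal.ofReal ε⁻¹ ^ p.toReal ≠ ∞ :=
      ENNReal.rpow_ne_top_of_nonneg hq0.le ENNReal.ofReal_ne_top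
    have hDt : D ≠ ∞ := hD ▸ ENNReal.mul_ne_top (ENNReal.inv_ne_top.2 hκ0)
      (ENNReal.mul_ne_top hεt ENNReal.ofReal_ne_top)
    have hDt' : D ^ (1 / p.toReal) ≠ ∞ := ENNReal.rpow_ne_top_of_nonneg (by positivity) hDt
    refine ⟨(D ^ (1 / p.toReal)).toReal + 1, by positivity, fun f => ?_⟩
    have hint : ∫⁻ w in ψ '' {z | ε < weightL u ψ n z},
        ENNReal.ofReal (derivModulus n f.1 w) ^ p.toReal ≤ D * fockENorm p (T f).1 ^ p.toReal := by
      have h2 := hκ {z | ε < weightL u ψ n z}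
        (fun w => ENNReal.ofReal (derivModulus n f.1 w) ^ p.toReal)
      have h3 : ∫⁻ z in {z | ε < weightL u ψ n z},
          ENNReal.ofReal (derivModulus n f.1 (ψ z)) ^ p.toReal ≤
          ENNReal.ofReal ε⁻¹ ^ p.toReal * ∫⁻ z, ENNReal.ofReal (gaussModulus (T f).1 z) ^ p.toReal := by
        rw [← lintegral_const_mul' _ _ hεt]
        refine le_trans (setLIntegral_mono_ae ?_ (ae_of_all _ fun z hz => ?_))
          (setLIntegral_le_lintegral {z | ε < weightL u ψ n z} _)
        · have := (continuous_gaussModulus (T f).2.1.continuous).measurable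
          fun_prop
        · rw [← ENNReal.mul_rpow_of_nonneg _ _ hq0.le, ← ENNReal.ofReal_mul (by positivity)]
          exact ENNReal.rpow_le_rpow (ENNReal.ofReal_le_ofReal (hpt f z hz)) hq0.le
      rw [lintegral_gaussModulus_eq h1 hp, h2] at h3
      rw [hD, mul_assoc, ← ENNReal.div_eq_inv_mul,
        ENNReal.le_div_iff_mul_le (Or.inl hκ0) (Or.inl hκt), mul_comm, mul_assoc]
      exact h3
    rw [samplingENorm_eq_lintegral hp, ENNReal.ofReal_mul (by positivity), FockSpace.norm_def,
      ENNReal.ofReal_toReal (T f).2.2.ne]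
    calc _ ≤ (D * fockENorm p (T f).1 ^ p.toReal) ^ (1 / p.toReal) :=
          ENNReal.rpow_le_rpow hint (by positivity)
      _ = D ^ (1 / p.toReal) * fockENorm p (T f).1 := by
        rw [ENNReal.mul_rpow_of_nonneg _ _ (by positivity), ← ENNReal.rpow_mul, mul_one_div,
          div_self hq0.ne', ENNReal.rpow_one]
      _ ≤ _ := by
        gcongr
        rw [ENNReal.le_ofReal_iff_toReal_le hDt' (by positivity)]
        linarith

theorem exists_isSamplingSet_top (hu : Differentiable ℂ u) (hu0 : u ≠ 0)
    (ha : a ≠ 0) [Fact (1 ≤ (∞ : ℝ≥0∞))] {T : FockSpace ∞ →L[ℂ] FockSpace ∞}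
    (hT : ∀ f : FockSpace ∞, T f = weightedCompDiff u (affineHomeomorph a b ha) n f)
    {V : Set (FockSpace ∞)} {c : ℝ} (hc : 0 < c) (hTc : ∀ f ∈ V, c * ‖f‖ ≤ ‖T f‖) :
    ∃ ε : ℝ, 0 < ε ∧ FockSpace.IsSamplingSet ∞ n
      (affineHomeomorph a b ha '' {z | ε < weightL u (affineHomeomorph a b ha) n z}) V := by
  obtain ⟨K, hK, hamp⟩ := exists_weightAmplitude_le (n := n) (b := b) hu.continuous ha ⟨T, hT⟩
  set ψ := affineHomeomorph a b ha with hψ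
  have hψd : Differentiable ℂ ψ := by
    change Differentiable ℂ fun z => a * z + b
    fun_prop
  have hgm : ∀ (f : FockSpace ∞) z, gaussModulus (T f).1 z =
      weightAmplitude u ψ n z * derivModulus n f.1 (ψ z) := fun f z => by
    rw [show (T f).1 = _ from hT f, gaussModulus_weightedCompDiff]
  obtain ⟨C, hC, hdm⟩ := exists_derivModulus_le ∞ Fact.out n
  -- The curve `|ψ| = r` surrounds `|ψ| < 1` and carries neither zeros of `u` nor, since `r ≥ 1`, of
  -- `ψ`. Hence `weightL` has a positive minimum on it.
  obtain ⟨r, hr1, hr⟩ := exists_radius_forall_ne_zero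
    (v := fun w => u ((w - b) / a)) (hu.comp (by fun_prop)) (fun h => hu0 (funext fun z => by
      have := congrFun h (a * z + b)
      simpa [mul_div_cancel_left₀ _ ha] using this)) 0 1
  have hur : ∀ z, ‖ψ z‖ = r → u z ≠ 0 := by
    intro z hz
    have := hr (ψ z) (by simpa using hz)
    simpa [hψ, affineHomeomorph_apply, mul_div_cancel_left₀ _ ha] using this
  have hLpos : ∀ z ∈ ψ ⁻¹' Metric.sphere 0 r, 0 < weightL u ψ n z := by
    intro z hz
    have hz' : ‖ψ z‖ = r := by simpa using hz
    have h1 := norm_pos_iff.2 (hur z hz')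
    unfold weightL
    rw [hz']
    positivity
  obtain ⟨ε₀, hε₀, hmin⟩ := (ψ.isCompact_preimage.2 (isCompact_sphere (0 : ℂ) r)).exists_forall_le'
    (continuous_weightL hu.continuous ψ.continuous n).continuousOn hLpos
  obtain ⟨R, hR⟩ :=
    (ψ.isCompact_preimage.2 (isCompact_closedBall (0 : ℂ) r)).isBounded.exists_norm_le
  -- The first entry puts the curve `|ψ| = r` inside `weightL > ε`. The second keeps the
  -- contribution of `weightL ≤ ε`, `|ψ| ≥ 1` below `(c/2)‖f‖`.
  set ε := min (ε₀ / 2) (c / 2 / (2 ^ n * C)) with hε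
  have hεpos : 0 < ε := lt_min (by positivity) (by positivity)
  set E := Real.exp (R ^ 2 / 2) with hE
  have hE1 : 1 ≤ E := Real.one_le_exp (by positivity)
  refine ⟨ε, hεpos, c / 2 / (K * E), by positivity, fun f hf => ?_⟩
  set σ := FockSpace.samplingENorm ∞ n (ψ '' {z | ε < weightL u ψ n z}) f.1 with hσ
  by_cases hσt : σ = ∞
  · rw [hσt]; exact le_top
  have hs : ∀ z, ε < weightL u ψ n z → gaussModulus (T f).1 z ≤ K * σ.toReal := by
    intro z hz
    rw [hgm]
    refine mul_le_mul (hamp z) ?_ (derivModulus_nonneg _ _ _) hK.le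
    rw [← ENNReal.ofReal_le_iff_le_toReal hσt, hσ, samplingENorm_top]
    exact le_iSup₂ (f := fun z (_ : z ∈ ψ '' {z | ε < weightL u ψ n z}) =>
      ENNReal.ofReal (derivModulus n f.1 z)) (ψ z) ⟨z, hz, rfl⟩
  have hσ0 : 0 ≤ σ.toReal := ENNReal.toReal_nonneg
  have hall : ∀ z, gaussModulus (T f).1 z ≤ K * E * σ.toReal + c / 2 * ‖f‖ := by
    intro z
    have hf0 := norm_nonneg f
    have hKE : K * σ.toReal ≤ K * E * σ.toReal := by
      rw [mul_assoc]
      gcongr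
      exact le_mul_of_one_le_left hσ0 hE1
    have hcf : 0 ≤ c / 2 * ‖f‖ := by positivity
    have hKEs : 0 ≤ K * E * σ.toReal := by positivity
    rcases le_or_gt 1 ‖ψ z‖ with hz1 | hz1
    · rcases lt_or_ge ε (weightL u ψ n z) with hz | hz
      · linarith [hs z hz]
      · have h2 : weightAmplitude u ψ n z ≤ 2 ^ n * (c / 2 / (2 ^ n * C)) := by
          refine (weightAmplitude_le u ψ n hz1).trans ?_
          gcongr
          exact hz.trans (min_le_right _ _)
        have h3 : gaussModulus (T f).1 z ≤ c / 2 * ‖f‖ := by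
          rw [hgm]
          calc weightAmplitude u ψ n z * derivModulus n f.1 (ψ z)
              ≤ 2 ^ n * (c / 2 / (2 ^ n * C)) * (C * ‖f‖) := by
                refine mul_le_mul h2 (hdm f.1 f.2.1 f.2.2.ne _) (derivModulus_nonneg _ _ _)
                  (by positivity)
            _ = c / 2 * ‖f‖ := by field_simp
        linarith
    · set U := ψ ⁻¹' Metric.ball 0 r with hU
      have hUsub : closure U ⊆ ψ ⁻¹' Metric.closedBall 0 r := by
        refine closure_minimal (Set.preimage_mono Metric.ball_subset_closedBall) ?_
        exact Metric.isClosed_closedBall.preimage ψ.continuous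
      have hUb : Bornology.IsBounded U :=
        (ψ.isCompact_preimage.2 (isCompact_closedBall (0 : ℂ) r)).isBounded.subset
          (subset_closure.trans hUsub)
      have hzU : z ∈ U := by
        rw [hU, Set.mem_preimage, mem_ball_zero_iff]; linarith
      -- The maximum principle applies to the unweighted `T f`; `E` is the price of removing the
      -- Gaussian weight on the boundary curve.
      have hmax : ‖(T f).1 z‖ ≤ K * E * σ.toReal := by
        refine Complex.norm_le_of_forall_mem_frontier_norm_le hUb (T f).2.1.diffContOnCl
          (fun ζ hζ => ?_) (subset_closure hzU)
        have hζb : ζ ∈ ψ ⁻¹' Metric.closedBall 0 r := hUsub (frontier_subset_closure hζ)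
        have hζs : ζ ∈ ψ ⁻¹' Metric.sphere 0 r := by
          have hUo : IsOpen U := Metric.isOpen_ball.preimage ψ.continuous
          have hnot : ζ ∉ U := by
            rw [hUo.frontier_eq] at hζ
            exact hζ.2
          rw [hU, Set.mem_preimage, mem_ball_zero_iff, not_lt] at hnot
          rw [Set.mem_preimage, mem_closedBall_zero_iff] at hζb
          rw [Set.mem_preimage, mem_sphere_zero_iff_norm]
          exact le_antisymm hζb hnot
        have h4 := hs ζ (lt_of_le_of_lt (min_le_left _ _)
          (lt_of_lt_of_le (half_lt_self hε₀) (hmin ζ hζs)))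
        have h5 : ‖(T f).1 ζ‖ = gaussModulus (T f).1 ζ * Real.exp (‖ζ‖ ^ 2 / 2) := by
          rw [gaussModulus, mul_assoc, ← Real.exp_add, neg_div, neg_add_cancel, Real.exp_zero,
            mul_one]
        have h6 : ‖ζ‖ ^ 2 ≤ R ^ 2 := by
          have := hR ζ hζb
          gcongr
        calc ‖(T f).1 ζ‖ ≤ K * σ.toReal * E := by
              rw [h5, hE]
              gcongr
          _ = _ := by ring
      have h7 : gaussModulus (T f).1 z ≤ ‖(T f).1 z‖ := by
        refine mul_le_of_le_one_right (norm_nonneg _) (Real.exp_le_one_iff.2 ?_)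
        nlinarith [sq_nonneg ‖z‖]
      linarith
  have hf0 := norm_nonneg f
  have hTn : ‖T f‖ ≤ K * E * σ.toReal + c / 2 * ‖f‖ := by
    rw [FockSpace.norm_def]
    refine ENNReal.toReal_le_of_le_ofReal (by positivity) ?_
    rw [fockENorm_top]
    exact iSup_le fun z => ENNReal.ofReal_le_ofReal (hall z)
  have hfin := hTc f hf
  rw [ENNReal.ofReal_le_iff_le_toReal hσt, div_mul_eq_mul_div, div_le_iff₀ (by positivity)]
  linarith

/-- The sublevel sets decrease to the zero set of `u ψ^n`, which is countable, and `B` has finite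
area. -/
theorem tendsto_volume_weightL_le {ψ : ℂ → ℂ} (hu : Differentiable ℂ u) (hψ : Differentiable ℂ ψ)
    (hv0 : (fun z => u z * ψ z ^ n) ≠ 0) {B : Set ℂ} (hB : MeasurableSet B) (hBt : volume B ≠ ∞) :
    Tendsto (fun m : ℕ => volume ({z | weightL u ψ n z ≤ 1 / ((m : ℝ) + 1)} ∩ B)) atTop (𝓝 0) := by
  have hLc := continuous_weightL hu.continuous hψ.continuous n
  have h := tendsto_measure_iInter_atTop (μ := (volume : Measure ℂ))
    (s := fun m : ℕ => {z | weightL u ψ n z ≤ 1 / ((m : ℝ) + 1)} ∩ B)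
    (fun m => ((isClosed_le hLc continuous_const).measurableSet.inter hB).nullMeasurableSet)
    (fun m k hmk => Set.inter_subset_inter_left _ fun z hz =>
      (show weightL u ψ n z ≤ _ from hz).trans (Nat.one_div_le_one_div hmk))
    ⟨0, measure_ne_top_of_subset Set.inter_subset_right hBt⟩
  have h0 : volume (⋂ m : ℕ, {z | weightL u ψ n z ≤ 1 / ((m : ℝ) + 1)} ∩ B) = 0 := by
    refine measure_mono_null (fun z hz => ?_)
      ((countable_zeros (hu.mul (hψ.pow n)) hv0).measure_zero volume)
    rw [Set.mem_iInter] at hz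
    have hle : weightL u ψ n z ≤ 0 :=
      ge_of_tendsto' tendsto_one_div_add_atTop_nhds_zero_nat fun m => (hz m).1
    have hex := Real.exp_pos ((‖ψ z‖ ^ 2 - ‖z‖ ^ 2) / 2)
    have hnn : ‖u z‖ * ‖ψ z‖ ^ n ≤ 0 := by
      by_contra hcon
      exact absurd hle (not_le.2 (mul_pos (not_le.1 hcon) hex))
    rw [← norm_pow, ← norm_mul] at hnn
    exact norm_le_zero_iff.1 hnn
  rw [h0] at h
  exact h

theorem exists_isSamplingSet_of_ne_top (hp : p ≠ ∞) (hu : Differentiable ℂ u) (ha : a ≠ 0)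
    (hv0 : (fun z => u z * affineHomeomorph a b ha z ^ n) ≠ 0) {T : FockSpace p →L[ℂ] FockSpace p}
    (hT : ∀ f : FockSpace p, T f = weightedCompDiff u (affineHomeomorph a b ha) n f)
    {V : Set (FockSpace p)} {c : ℝ} (hc : 0 < c) (hTc : ∀ f ∈ V, c * ‖f‖ ≤ ‖T f‖) :
    ∃ ε : ℝ, 0 < ε ∧ FockSpace.IsSamplingSet p n
      (affineHomeomorph a b ha '' {z | ε < weightL u (affineHomeomorph a b ha) n z}) V := by
  obtain ⟨K, hK, hamp⟩ := exists_weightAmplitude_le (n := n) (b := b) hu.continuous ha ⟨T, hT⟩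
  obtain ⟨κ, hκ0, hκt, hκ⟩ := exists_setLIntegral_comp_affine ha b
  set ψ := affineHomeomorph a b ha with hψ
  have h1 : 1 ≤ p := Fact.out
  set q := p.toReal with hqdef
  have hq : 1 ≤ q := one_le_toReal h1 hp
  have hq0 : 0 < q := by linarith
  have hpi := Real.pi_pos
  have hψd : Differentiable ℂ ψ := by
    change Differentiable ℂ fun z => a * z + b
    fun_prop
  have hLc := continuous_weightL hu.continuous hψd.continuous n
  have hgm : ∀ (f : FockSpace p) z, gaussModulus (T f).1 z =
      weightAmplitude u ψ n z * derivModulus n f.1 (ψ z) := fun f z => by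
    rw [show (T f).1 = _ from hT f, gaussModulus_weightedCompDiff]
  have hrt : ∀ x : ℝ, ENNReal.ofReal x ^ q ≠ ∞ := fun x =>
    ENNReal.rpow_ne_top_of_nonneg hq0.le ENNReal.ofReal_ne_top
  have hrp : ∀ x : ℝ, 0 < x → ENNReal.ofReal x ^ q ≠ 0 := fun x hx =>
    (ENNReal.rpow_pos (ENNReal.ofReal_pos.2 hx) ENNReal.ofReal_ne_top).ne'
  obtain ⟨C, hC, hdm⟩ := exists_derivModulus_le p h1 n
  obtain ⟨C₂, hC₂, hint⟩ := lintegral_derivModulus_le n hq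
  set κ₂ := ENNReal.ofReal (2 * Real.pi / q) with hκ₂
  have hκ₂0 : κ₂ ≠ 0 := (ENNReal.ofReal_pos.2 (by positivity)).ne'
  set B : Set ℂ := ψ ⁻¹' Metric.ball 0 1 with hB
  have hBm : MeasurableSet B := Metric.isOpen_ball.measurableSet.preimage ψ.measurable
  have hBt : volume B ≠ ∞ := by
    refine measure_ne_top_of_subset (Set.preimage_mono Metric.ball_subset_closedBall)
      (IsCompact.measure_ne_top ?_)
    exact ψ.isCompact_preimage.2 (isCompact_closedBall (0 : ℂ) 1)
  -- With this `η` the lower bound reads `η‖f‖^q ≤ ∫ (|T f| e^{-|z|²/2})^q`; half of it is reserved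
  -- for absorbing the errors.
  set η := κ₂ * ENNReal.ofReal c ^ q with hη
  have hη0 : η ≠ 0 := mul_ne_zero hκ₂0 (hrp c hc)
  have hηt : η ≠ ∞ := ENNReal.mul_ne_top ENNReal.ofReal_ne_top (hrt c)
  have hη2 : η / 2 ≠ 0 := ENNReal.div_ne_zero.2 ⟨hη0, ENNReal.ofNat_ne_top⟩
  have hη2t : η / 2 ≠ ∞ := ENNReal.div_ne_top hηt two_ne_zero
  -- The two summands are the coefficients of `‖f‖^q` coming from the region of small area inside
  -- `|ψ| < 1` and from the region of small amplitude outside it.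
  have hlim : Tendsto (fun m : ℕ => ENNReal.ofReal (K * C) ^ q *
      volume ({z | weightL u ψ n z ≤ 1 / ((m : ℝ) + 1)} ∩ B) +
      ENNReal.ofReal (2 ^ n * (1 / ((m : ℝ) + 1))) ^ q * (κ * (C₂ * κ₂))) atTop (𝓝 0) := by
    have l1 := ENNReal.Tendsto.const_mul (a := ENNReal.ofReal (K * C) ^ q)
      (tendsto_volume_weightL_le (n := n) hu hψd hv0 hBm hBt) (Or.inr (hrt _))
    have l2 : Tendsto (fun m : ℕ => ENNReal.ofReal (2 ^ n * (1 / ((m : ℝ) + 1))) ^ q)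
        atTop (𝓝 0) := by
      have := (ENNReal.continuous_rpow_const (y := q)).continuousAt.tendsto.comp
        (ENNReal.tendsto_ofReal
          ((tendsto_one_div_add_atTop_nhds_zero_nat (𝕜 := ℝ)).const_mul ((2 : ℝ) ^ n)))
      simpa [hq0, Function.comp_def] using! this
    have l3 := ENNReal.Tendsto.mul_const (b := κ * (C₂ * κ₂)) l2
      (Or.inr (ENNReal.mul_ne_top hκt (ENNReal.mul_ne_top hC₂ ENNReal.ofReal_ne_top)))
    simpa using l1.add l3
  obtain ⟨m, hm⟩ := (hlim.eventually (gt_mem_nhds (pos_iff_ne_zero.2 hη2))).exists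
  set ε : ℝ := 1 / ((m : ℝ) + 1) with hε
  have hεpos : 0 < ε := by positivity
  set A := {z | ε < weightL u ψ n z} with hA
  have hAm : MeasurableSet A := (isOpen_lt continuous_const hLc).measurableSet
  set N := {z | weightL u ψ n z ≤ ε} ∩ B with hN
  have hNm : MeasurableSet N := (isClosed_le hLc continuous_const).measurableSet.inter hBm
  set G := ENNReal.ofReal K ^ q * κ with hG
  have hG0 : G ≠ 0 := mul_ne_zero (hrp K hK) hκ0
  have hGt : G ≠ ∞ := ENNReal.mul_ne_top (hrt K) hκt
  set D := (η / 2 / G) ^ (1 / q) with hD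
  have hDt : D ≠ ∞ := ENNReal.rpow_ne_top_of_nonneg (by positivity) (ENNReal.div_ne_top hη2t hG0)
  have hD0 : 0 < D := ENNReal.rpow_pos (pos_iff_ne_zero.2 (ENNReal.div_ne_zero.2 ⟨hη2, hGt⟩))
    (ENNReal.div_ne_top hη2t hG0)
  refine ⟨ε, hεpos, D.toReal, ENNReal.toReal_pos hD0.ne' hDt, fun f hf => ?_⟩
  set X := fockENorm p f.1 with hX
  have hXt : X ≠ ∞ := f.2.2.ne
  have hdmm := (continuous_derivModulus f.2.1 n).measurable
  have hψm : Measurable ψ := ψ.measurable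
  set g : ℂ → ℝ≥0∞ := fun w => ENNReal.ofReal (derivModulus n f.1 w) ^ q with hg
  have hgmeas : Measurable g := by fun_prop
  -- One summand for each of the three regions. The last needs no indicator, because its integral
  -- over the whole plane is already controlled by `‖f‖^q`.
  have hpt : ∀ z, ENNReal.ofReal (gaussModulus (T f).1 z) ^ q ≤
      A.indicator (fun z => ENNReal.ofReal K ^ q * g (ψ z)) z +
      N.indicator (fun _ => ENNReal.ofReal (K * C) ^ q * X ^ q) z +
      ENNReal.ofReal (2 ^ n * ε) ^ q * g (ψ z) := by
    intro z
    have hbound : ∀ y, weightAmplitude u ψ n z ≤ y → 0 ≤ y →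
        ENNReal.ofReal (gaussModulus (T f).1 z) ^ q ≤ ENNReal.ofReal y ^ q * g (ψ z) := by
      intro y hy hy0
      rw [hgm, hg, ← ENNReal.mul_rpow_of_nonneg _ _ hq0.le, ← ENNReal.ofReal_mul hy0]
      exact ENNReal.rpow_le_rpow (ENNReal.ofReal_le_ofReal
        (mul_le_mul_of_nonneg_right hy (derivModulus_nonneg _ _ _))) hq0.le
    rcases lt_or_ge ε (weightL u ψ n z) with hz | hz
    · rw [Set.indicator_of_mem (show z ∈ A from hz), add_assoc]
      exact (hbound K (hamp z) hK.le).trans le_self_add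
    · by_cases hzB : z ∈ B
      · rw [Set.indicator_of_mem (show z ∈ N from ⟨hz, hzB⟩), add_right_comm]
        refine le_trans ((hbound K (hamp z) hK.le).trans ?_) le_add_self
        rw [hg, ENNReal.ofReal_mul hK.le, ENNReal.mul_rpow_of_nonneg _ _ hq0.le, mul_assoc,
          ← ENNReal.mul_rpow_of_nonneg (ENNReal.ofReal C) _ hq0.le]
        gcongr
        rw [← ENNReal.ofReal_toReal hXt, ← ENNReal.ofReal_mul hC.le]
        exact ENNReal.rpow_le_rpow (ENNReal.ofReal_le_ofReal (hdm f.1 f.2.1 hXt _)) hq0.le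
      · have hz1 : 1 ≤ ‖ψ z‖ := by simpa [hB] using hzB
        refine le_trans (hbound (2 ^ n * ε) ?_ (by positivity)) le_add_self
        exact (weightAmplitude_le u ψ n hz1).trans (by gcongr)
  set Y := ∫⁻ w in ψ '' A, g w with hY
  have hsum : η * X ^ q ≤ G * Y + η / 2 * X ^ q := by
    calc η * X ^ q ≤ ∫⁻ z, ENNReal.ofReal (gaussModulus (T f).1 z) ^ q := by
          rw [lintegral_gaussModulus_eq h1 hp, hη, mul_assoc,
            ← ENNReal.mul_rpow_of_nonneg _ _ hq0.le]
          gcongr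
          have h2 := ENNReal.ofReal_le_ofReal (hTc f hf)
          rwa [ENNReal.ofReal_mul hc.le, FockSpace.norm_def, FockSpace.norm_def,
            ENNReal.ofReal_toReal hXt, ENNReal.ofReal_toReal (T f).2.2.ne] at h2
      _ ≤ ∫⁻ z, (A.indicator (fun z => ENNReal.ofReal K ^ q * g (ψ z)) z +
            N.indicator (fun _ => ENNReal.ofReal (K * C) ^ q * X ^ q) z +
            ENNReal.ofReal (2 ^ n * ε) ^ q * g (ψ z)) := lintegral_mono hpt
      _ = G * Y + ENNReal.ofReal (K * C) ^ q * X ^ q * volume N +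
            ENNReal.ofReal (2 ^ n * ε) ^ q * (κ * ∫⁻ w, g w) := by
          rw [lintegral_add_right _ (by fun_prop),
            lintegral_add_right _ (measurable_const.indicator hNm), lintegral_indicator hAm,
            lintegral_indicator_const hNm, lintegral_const_mul' _ _ (hrt K), hκ A g,
            lintegral_const_mul' _ _ (hrt _), hG, mul_assoc _ κ]
          congr 2
          have h2 := hκ Set.univ g
          rwa [Measure.restrict_univ, Set.image_univ, ψ.range_coe, Measure.restrict_univ] at h2
      _ ≤ G * Y + ENNReal.ofReal (K * C) ^ q * X ^ q * volume N +
            ENNReal.ofReal (2 ^ n * ε) ^ q * (κ * (C₂ * (κ₂ * X ^ q))) := by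
          gcongr
          rw [hκ₂, ← lintegral_gaussModulus_eq h1 hp]
          exact hint f.1 f.2.1
      _ = G * Y + (ENNReal.ofReal (K * C) ^ q * volume N +
            ENNReal.ofReal (2 ^ n * ε) ^ q * (κ * (C₂ * κ₂))) * X ^ q := by ring
      _ ≤ _ := by gcongr
  have hXq : X ^ q ≠ ∞ := ENNReal.rpow_ne_top_of_nonneg hq0.le hXt
  -- Cancelling the absorbed half is legitimate because `‖f‖` is finite.
  have hhalf : η / 2 * X ^ q ≤ G * Y := by
    rw [← ENNReal.add_halves η, add_mul] at hsum
    rw [ENNReal.add_halves η] at hsum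
    exact (ENNReal.add_le_add_iff_right (ENNReal.mul_ne_top hη2t hXq)).1 hsum
  have hfinal : η / 2 / G * X ^ q ≤ Y := by
    rw [← ENNReal.mul_div_right_comm, ENNReal.div_le_iff_le_mul (Or.inl hG0) (Or.inl hGt),
      mul_comm Y]
    exact hhalf
  rw [samplingENorm_eq_lintegral hp, ENNReal.ofReal_mul ENNReal.toReal_nonneg,
    ENNReal.ofReal_toReal hDt, FockSpace.norm_def, ENNReal.ofReal_toReal hXt]
  calc D * X = (η / 2 / G * X ^ q) ^ (1 / q) := by
        rw [ENNReal.mul_rpow_of_nonneg _ _ (by positivity), ← ENNReal.rpow_mul, mul_one_div,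
          div_self hq0.ne', ENNReal.rpow_one]
    _ ≤ Y ^ (1 / q) := ENNReal.rpow_le_rpow hfinal (by positivity)

end Affine

end

/-! ### The equivalence. -/

theorem mainTheorem3 (p : ENNReal) [Fact (1 ≤ p)] (n : ℕ) (u ψ : ℂ → ℂ)
    (hu : Differentiable ℂ u) (hψ : Differentiable ℂ ψ)
    (hu0 : u ≠ 0) (hψc : ¬ ∃ c : ℂ, ∀ z, ψ z = c)
    (hD : IsBoundedOnFock p u ψ n) :
    IsClosed (rangeOnFock p u ψ n) ↔
      ∃ ε : ℝ, 0 < ε ∧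
        FockSpace.IsSamplingSet p n (ψ '' {z : ℂ | ε < weightL u ψ n z})
          (FockSpace.vanishing p n) := by
  have hv0 : (fun z => u z * ψ z ^ n) ≠ 0 := mul_pow_ne_zero hu hψ hu0 hψc n
  obtain ⟨a, b, ha, hab⟩ := exists_affine hu hψ hu0 hψc hD
  obtain rfl : ψ = affineHomeomorph a b ha := funext hab
  obtain ⟨T, hT⟩ := hD
  rw [isClosed_rangeOnFock_iff hu hu0 ha hab hT]
  constructor
  · rintro ⟨c, hc, hTc⟩
    by_cases hp : p = ∞
    · subst hp
      exact exists_isSamplingSet_top hu hu0 ha hT hc hTc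
    · exact exists_isSamplingSet_of_ne_top hp hu ha hv0 hT hc hTc
  · rintro ⟨ε, hε, δ, hδ, h⟩
    obtain ⟨C, hC, hle⟩ := exists_samplingENorm_le ha hT hε
    refine ⟨δ / C, by positivity, fun f hf => ?_⟩
    have h2 := (h f hf).trans (hle f)
    rw [ENNReal.ofReal_le_ofReal_iff (by positivity)] at h2
    rw [div_mul_eq_mul_div, div_le_iff₀ hC, mul_comm ‖T f‖]
    exact h2
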